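/- Let $n,m,h$ be natural numbers with $h\ge 1$. Consider a system $$\frac{\partial^h u^i}{\partial t^h}=F^i,\qquad i=1,\dots,m, \tag{1}$$ in the independent variables $t,x_1,\dots,x_n$. For $I\in\mathbb Z_+^n$ write $|I|=i_1+\dots+i_n$ and $u^i_{s,I}=\partial_t^s\partial_{x_1}^{i_1}\cdots\partial_{x_n}^{i_n}u^i$. The space with coordinates $t,\ x_j,\ u^i_{s,I}$ ($s<h$) carries the product topology, $U$ is an open subset of it, and all functions are real functions on $U$ that are smooth functions of finitely many of these coordinates; $F^i$ depends only on $t$, $x_j$, the $u^b_{0,I}$ and the $u^a_{s,0}$, $s<h$. The total derivatives are $$D_{x_j}=\partial_{x_j}+\sum_{k,s,I}u^k_{s,I+1_j}\frac{\partial}{\partial u^k_{s,I}},\qquad D_t=\partial_t+\sum_{k,I,\,s<h-1}u^k_{s+1,I}\frac{\partial}{\partial u^k_{s,I}}+\sum_{k,I}D_x^I(F^k)\frac{\partial}{\partial u^k_{h-1,I}} .$$ A conserved current is a tuple $J=(J_0,\dots,J_n)$ with $D_tJ_0+\sum_jD_{x_j}J_j=0$. With $D_0=D_t$, $D_j=D_{x_j}$,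 it is trivial if $J_k=\sum_{l<k}D_l(\mathcal L_{lk})-\sum_{k<l}D_l(\mathcal L_{kl})$ for some functions $\mathcal L_{kl}$. A conservation law is a class of conserved currents modulo trivial ones; its characteristic is $\chi=(\chi_1,\dots,\chi_m)$, $\chi_i=\sum_I(-1)^{|I|}D_x^I\bigl(\partial J_0/\partial u^i_{h-1,I}\bigr)$. The order $\mathrm o(f)$ of a (vector-)function $f$ is the largest $|I|$ such that $\partial f/\partial u^j_{s,I}\not\equiv 0$ for some $s,j$, and $-1$ if there is none; $\mathrm t(f)$ is the largest $s$ such that $\partial f/\partial u^j_{s,I}\not\equiv0$ for some $j$ and some $I$ with $|I|=\mathrm o(f)$. The symbol of $f$ at $\theta\in U$ is the matrix $\mathbf S_f(\theta)$ with entries $\sum_{|I|=\mathrm o(f)}\frac{\partial f_i}{\partial u^j_{\mathrm t(f),I}}(\theta)\,q^I\in\mathbb R[q_1,\dots,q_n]$. The order of a conservation law is the order of its characteristic. Put $N=\mathrm o(F^1,\dots,F^m)$, assume $N>0$, and let $A(\theta)=\mathbf S_F(\theta)$, regarded as a matrix over the field $\mathbb R(q_1,\dots,q_n)$. Using the Leibniz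 rule write the operators $$L_{ij}=\sum_I(-1)^{|I|}D_x^I\circ\frac{\partial F^j}{\partial u^i_{0,I}}+\sum_{0<s<h}(-1)^sD_t^s\circ\frac{\partial F^j}{\partial u^i_{s,0}}$$ as $\sum_{|I|\le N}f^{ij}_ID_x^I+\sum_{0<s<h}g^{ij}_sD_t^s$, and put $O=\max_{i,j,I,s}\{-1,\ \mathrm o(f^{ij}_I)-N,\ \mathrm o(g^{ij}_s)-N\}$. Theorem. Suppose that $N+h$ is odd and that (1) has a conservation law of order greater than $O$, with characteristic $\chi$. Then $\mathbf S_\chi(\theta)\ne0$ for some $\theta\in U$, and for every $\theta\in U$ with $\mathbf S_\chi(\theta)\neq 0$ the polynomials $d(\lambda)=\det(A(\theta)-\lambda\mathbf I)$ and $d(-\lambda)$ over $\mathbb R(q_1,\dots,q_n)$ have a common divisor of positive degree; equivalently, there are eigenvalues $\lambda_1,\lambda_2$ of $A(\theta)$ in the algebraic closure of $\mathbb R(q_1,\dots,q_n)$ with $\lambda_1+\lambda_2=0$. If, moreover, $U$ is connected and the $F^i$ are real analytic, then this holds at every $\theta\in U$. (The two forms of the conclusion are equivalent at every $\theta\in U$.)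 -/

import Mathlib

open scoped ContDiff

noncomputable section

namespace GenEvol

/-- The coordinates `t`, `x_j` and `u^i_{s,I}` with `s < h` on the infinite prolongation of a system
`∂^h u^i / ∂t^h = F^i` with `n` space variables and `m` unknown functions. Here `u^i_{s,I}` stands
for the derivative of `u^i` taken `s` times in `t` and `I j` times in each `x_j`. -/
inductive Coord (n m h : ℕ) : Type
  | t : Coord n m h
  | x (j : Fin n) : Coord n m h
  | u (i : Fin m) (s : Fin h) (I : Fin n →₀ ℕ) : Coord n m h
  deriving DecidableEq

/-- Points of the infinite prolongation, with the product topology. -/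
abbrev Jet (n m h : ℕ) : Type := Coord n m h → ℝ

/-- Functions of the coordinates. Only their values on the domain under consideration matter. -/
abbrev JetFun (n m h : ℕ) : Type := Jet n m h → ℝ

variable {n m h : ℕ}

/-- `f` is, on `U`, a function of class `C^r` of finitely many of the variables in `V`. -/
def IsFunOf (U : Set (Jet n m h)) (V : Set (Coord n m h)) (r : WithTop ℕ∞)
    (f : JetFun n m h) : Prop :=
  ∃ s : Finset (Coord n m h), (s : Set (Coord n m h)) ⊆ V ∧
    ∃ g : (s → ℝ) → ℝ, ContDiffOn ℝ r g (s.restrict '' U) ∧ ∀ θ ∈ U, f θ = g (s.restrict θ)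

/-- Elements of the algebra of smooth functions on `U`, each depending on finitely many coordinates. -/
def IsSmooth (U : Set (Jet n m h)) (f : JetFun n m h) : Prop :=
  IsFunOf U Set.univ ∞ f

/-- The partial derivative `∂f/∂c` with respect to the coordinate `c`. -/
def pd (c : Coord n m h) (f : JetFun n m h) : JetFun n m h :=
  fun θ => deriv (fun r : ℝ => f (Function.update θ c r)) (θ c)

/-- The total derivative with respect to `x_j`,
`∂/∂x_j + ∑ u^k_{s,I+1_j} ∂/∂u^k_{s,I}`. -/
def Dx (j : Fin n) (f : JetFun n m h) : JetFun n m h :=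
  fun θ => pd (.x j) f θ +
    ∑ᶠ p : Fin m × Fin h × (Fin n →₀ ℕ),
      θ (.u p.1 p.2.1 (p.2.2 + Finsupp.single j 1)) * pd (.u p.1 p.2.1 p.2.2) f θ

/-- The iterated total derivative `D_{x_1}^{I_1} ∘ ⋯ ∘ D_{x_n}^{I_n}`. -/
def DxI (I : Fin n →₀ ℕ) (f : JetFun n m h) : JetFun n m h :=
  (List.finRange n).foldr (fun j g => (Dx j)^[I j] g) f

/-- The variables `t`, `x_j`, `u^b_{0,I}`, `u^a_{s,0}` on which the right-hand sides may depend. -/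
def admissibleVars (n m h : ℕ) : Set (Coord n m h) :=
  {c | ∀ (i : Fin m) (s : Fin h) (I : Fin n →₀ ℕ), c = .u i s I → (s : ℕ) = 0 ∨ I = 0}

/-- A system `∂^h u^i / ∂t^h = F^i`, `i = 1, …, m`, of generalized evolution form, with right-hand
sides smooth on an open domain `U`. -/
structure GenEvolSystem (n m h : ℕ) where
  h_pos : 0 < h
  U : Set (Jet n m h)
  isOpen_U : IsOpen U
  F : Fin m → JetFun n m h
  smooth_F : ∀ i, IsFunOf U (admissibleVars n m h) ∞ (F i)

/-- The order of a vector-function on `U`: the largest `|I|` such that `f` really depends on some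
`u^j_{s,I}`, and `-1` if there is none. -/
def order (U : Set (Jet n m h)) {k : ℕ} (f : Fin k → JetFun n m h) : ℤ :=
  sSup (insert (-1) {d : ℤ | ∃ (i : Fin k) (j : Fin m) (s : Fin h) (I : Fin n →₀ ℕ),
    (∃ θ ∈ U, pd (.u j s I) (f i) θ ≠ 0) ∧ d = (I.degree : ℤ)})

/-- The largest `s` such that `f` really depends on some `u^j_{s,I}` with `|I|` the order of `f`. -/
def tOrder (U : Set (Jet n m h)) {k : ℕ} (f : Fin k → JetFun n m h) : ℕ :=
  sSup {b : ℕ | ∃ (i : Fin k) (j : Fin m) (s : Fin h) (I : Fin n →₀ ℕ),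
    (∃ θ ∈ U, pd (.u j s I) (f i) θ ≠ 0) ∧ (I.degree : ℤ) = order U f ∧ b = (s : ℕ)}

/-- The matrix with entries `∑_{|I| = a} (∂f_i/∂u^j_{b,I}) q^I`, its coefficients evaluated
at `θ`. -/
def symbolMatrix (a b : ℕ) {k : ℕ} (f : Fin k → JetFun n m h) (θ : Jet n m h) :
    Matrix (Fin k) (Fin m) (MvPolynomial (Fin n) ℝ) :=
  Matrix.of fun i j => ∑ I ∈ Finset.finsuppAntidiag (Finset.univ : Finset (Fin n)) a,
    MvPolynomial.monomial I (if hb : b < h then pd (.u j ⟨b, hb⟩ I) (f i) θ else 0)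

/-- The symbol of a vector-function, its coefficients evaluated at `θ`. -/
def symbol (U : Set (Jet n m h)) {k : ℕ} (f : Fin k → JetFun n m h) (θ : Jet n m h) :
    Matrix (Fin k) (Fin m) (MvPolynomial (Fin n) ℝ) :=
  symbolMatrix (order U f).toNat (tOrder U f) f θ

/-- The field of rational functions in `q_1, …, q_n`. -/
abbrev RatFunc (n : ℕ) : Type := FractionRing (MvPolynomial (Fin n) ℝ)

namespace GenEvolSystem

variable (E : GenEvolSystem n m h)

/-- The expression for the time derivative of `u^k_{s,I}`: it is `u^k_{s+1,I}` if `s < h - 1` and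
`D_x^I(F^k)` if `s = h - 1`. -/
def dtCoord (k : Fin m) (s : Fin h) (I : Fin n →₀ ℕ) : JetFun n m h :=
  fun θ => if hs : (s : ℕ) + 1 < h then θ (.u k ⟨s + 1, hs⟩ I) else DxI I (E.F k) θ

/-- The total derivative with respect to `t`, restricted to the system. -/
def Dt (f : JetFun n m h) : JetFun n m h :=
  fun θ => pd .t f θ +
    ∑ᶠ p : Fin m × Fin h × (Fin n →₀ ℕ),
      E.dtCoord p.1 p.2.1 p.2.2 θ * pd (.u p.1 p.2.1 p.2.2) f θ

/-- The total derivatives, numbered so that `0` is the one in `t` and `j + 1` the one in `x_j`. -/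
def totalD (k : Fin (n + 1)) : JetFun n m h → JetFun n m h :=
  Fin.cases (motive := fun _ => JetFun n m h → JetFun n m h) E.Dt (fun j => Dx j) k

/-- Conserved currents `(J_0, J_1, …, J_n)`. -/
def IsConservedCurrent (J : Fin (n + 1) → JetFun n m h) : Prop :=
  (∀ k, IsSmooth E.U (J k)) ∧ ∀ θ ∈ E.U, ∑ k, E.totalD k (J k) θ = 0

/-- Trivial currents. -/
def IsTrivialCurrent (J : Fin (n + 1) → JetFun n m h) : Prop :=
  ∃ Λ : Fin (n + 1) → Fin (n + 1) → JetFun n m h, (∀ k l, IsSmooth E.U (Λ k l)) ∧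
    ∀ k, ∀ θ ∈ E.U, J k θ =
      ∑ l ∈ Finset.Iio k, E.totalD l (Λ l k) θ - ∑ l ∈ Finset.Ioi k, E.totalD l (Λ k l) θ

/-- Conservation laws: classes of conserved currents modulo trivial ones. -/
def IsConservationLaw (c : Set (Fin (n + 1) → JetFun n m h)) : Prop :=
  ∃ J, E.IsConservedCurrent J ∧
    c = {J' | E.IsConservedCurrent J' ∧ E.IsTrivialCurrent (J' - J)}

/-- The characteristic `χ_i = ∑_I (-1)^{|I|} D_x^I (∂J_0/∂u^i_{h-1,I})` of a current. -/
def currentCharacteristic (J : Fin (n + 1) → JetFun n m h) (i : Fin m) : JetFun n m h :=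
  fun θ => ∑ᶠ I : Fin n →₀ ℕ,
    (-1 : ℝ) ^ I.degree *
      DxI I (pd (.u i ⟨h - 1, Nat.sub_lt E.h_pos Nat.one_pos⟩ I) (J 0)) θ

/-- `χ` is the characteristic of the conservation law `c`. -/
def IsCharacteristic (c : Set (Fin (n + 1) → JetFun n m h)) (χ : Fin m → JetFun n m h) : Prop :=
  ∃ J ∈ c, ∀ i, ∀ θ ∈ E.U, χ i θ = E.currentCharacteristic J i θ

/-- The number `N`, the order of the right-hand side (meant for systems where it is positive). -/
def N : ℕ := (order E.U E.F).toNat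

/- The operator of the adjoint linearized equation `(-1)^h D_t^h χ = L χ` has the entries
`L_{ij} = ∑_I (-1)^{|I|} D_x^I ∘ ∂F^j/∂u^i_{0,I} + ∑_{0 < s < h} (-1)^s D_t^s ∘ ∂F^j/∂u^i_{s,0}`.
By the Leibniz rule `D^I ∘ a = ∑_{J ≤ I} binom(I, J) D^{I-J}(a) D^J` it takes the form
`L_{ij} = ∑_J coeffX i j J • D_x^J + ∑_{0 < r < h} coeffT i j r • D_t^r`. -/

/-- The coefficient of `D_x^J` in `L_{ij}`; the one of the identity (`J = 0`) also gets the
zeroth-order contributions of the operators `D_t^s ∘ ∂F^j/∂u^i_{s,0}`, `0 < s < h`. -/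
def coeffX (i j : Fin m) (J : Fin n →₀ ℕ) : JetFun n m h :=
  fun θ =>
    (∑ᶠ K : Fin n →₀ ℕ,
      (-1 : ℝ) ^ (J + K).degree * (∏ l, ((J l + K l).choose (J l) : ℝ)) *
        DxI K (pd (.u i ⟨0, E.h_pos⟩ (J + K)) (E.F j)) θ) +
    if J = 0 then
      ∑ s : Fin h, if 0 < (s : ℕ) then
        (-1 : ℝ) ^ (s : ℕ) * (E.Dt)^[(s : ℕ)] (pd (.u i s 0) (E.F j)) θ else 0
    else 0

/-- The coefficient of `D_t^r`, `0 < r < h`, in `L_{ij}`. -/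
def coeffT (i j : Fin m) (r : ℕ) : JetFun n m h :=
  fun θ => ∑ s : Fin h, if r ≤ (s : ℕ) then
    (-1 : ℝ) ^ (s : ℕ) * ((s : ℕ).choose r : ℝ) *
      (E.Dt)^[(s : ℕ) - r] (pd (.u i s 0) (E.F j)) θ else 0

/-- The order of a single function on the domain of the system. -/
def ord (f : JetFun n m h) : ℤ := order E.U (fun _ : Fin 1 => f)

/-- The number `O`, the maximum of `-1` and of the orders of the coefficients of `L` minus `N`. -/
def O : ℤ :=
  sSup (insert (-1)
    ({d : ℤ | ∃ (i j : Fin m) (J : Fin n →₀ ℕ), J.degree ≤ E.N ∧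
        d = E.ord (E.coeffX i j J) - E.N} ∪
     {d : ℤ | ∃ (i j : Fin m) (r : ℕ), 0 < r ∧ r < h ∧
        d = E.ord (E.coeffT i j r) - E.N}))

/-- The symbol `A` of the right-hand side at `θ`, as a matrix over the field of rational functions
in `q_1, …, q_n`. -/
def A (θ : Jet n m h) : Matrix (Fin m) (Fin m) (RatFunc n) :=
  (symbol E.U E.F θ).map (algebraMap (MvPolynomial (Fin n) ℝ) (RatFunc n))

end GenEvolSystem

/-- The characteristic polynomial in the normalization `d(λ) = det (A - λ I)`. -/
def charDet {K : Type*} [Field K] (A : Matrix (Fin m) (Fin m) K) : Polynomial K :=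
  (A.map Polynomial.C - Matrix.scalar (Fin m) (Polynomial.X : Polynomial K)).det

/-- `d(λ)` and `d(-λ)` have a common divisor of positive degree. -/
def HasCommonDivisor {K : Type*} [Field K] (A : Matrix (Fin m) (Fin m) K) : Prop :=
  ∃ p : Polynomial K, 0 < p.natDegree ∧ p ∣ charDet A ∧
    p ∣ (charDet A).comp (-Polynomial.X)

/-- There are eigenvalues of `A` in the algebraic closure of the field whose sum is zero. -/
def HasOppositeEigenvalues {K : Type*} [Field K] (A : Matrix (Fin m) (Fin m) K) : Prop :=
  ∃ μ₁ μ₂ : AlgebraicClosure K,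
    Module.End.HasEigenvalue
      (Matrix.toLin' (A.map (algebraMap K (AlgebraicClosure K)))) μ₁ ∧
    Module.End.HasEigenvalue
      (Matrix.toLin' (A.map (algebraMap K (AlgebraicClosure K)))) μ₂ ∧
    μ₁ + μ₂ = 0

end GenEvol

end

/-!
Along a conserved current the characteristic `χ` satisfies the adjoint linearized equation
`(-1)^h D_t^h χ = L χ`. Suppose the order `a` of `χ` exceeds `O` and put `r = t(χ)`. On
differentiating the equation with respect to the variables `u^j_{r,I}`, `|I| = a + N`, the
coefficients of `L` do not contribute, `D_t^h` trades `h` time derivatives for the principal part of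
`F`, and what is left is the matrix identity `(-1)^h S A = (-1)^N Aᵀ S` between the symbols
`S = S_χ(θ)` and `A = S_F(θ)`. As `N + h` is odd, `Aᵀ S + S A = 0`; if `S ≠ 0`, then `A` and `-Aᵀ`
have a common eigenvalue.

The existence of a nonzero `S` with `Aᵀ S + S A = 0` is the vanishing of a determinant that is
analytic in `θ` when `F` is, so it propagates from the nonempty open set `S_χ ≠ 0` to connected `U`.
-/

noncomputable section

namespace GenEvol

variable {n m h : ℕ}

section MultiIndex

open Finset

theorem finsupp_nat_induction {σ : Type*} {P : (σ →₀ ℕ) → Prop} (zero : P 0)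
    (add_single : ∀ I j, P I → P (I + Finsupp.single j 1)) (I : σ →₀ ℕ) : P I := by
  have add_single_nat (j : σ) (b : ℕ) (I : σ →₀ ℕ) (hI : P I) : P (I + Finsupp.single j b) := by
    induction b with
    | zero => simpa using hI
    | succ b ih => simpa only [Finsupp.single_add, ← add_assoc] using add_single _ j ih
  induction I using Finsupp.induction with
  | zero => exact zero
  | single_add j b I _ _ ih => exact add_comm I _ ▸ add_single_nat j b I ih

variable {M : Type*} [Monoid M]

/-- The ordered product `a_1 ^ I_1 ⋯ a_n ^ I_n`, used for the monomials in the total derivatives. -/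
def multiPow (a : Fin n → M) (I : Fin n →₀ ℕ) : M :=
  ((List.finRange n).map fun j => a j ^ I j).prod

@[simp]
theorem multiPow_zero (a : Fin n → M) : multiPow a 0 = 1 := by
  simp [multiPow]

theorem multiPow_single (a : Fin n → M) (j : Fin n) (b : ℕ) :
    multiPow a (Finsupp.single j b) = a j ^ b := by
  classical
  rw [multiPow, List.prod_map_eq_pow_single j, List.count_finRange]
  · simp
  · intro i hi _
    simp [Finsupp.single_eq_of_ne hi]

theorem commute_multiPow {a : Fin n → M} {b : M} (hb : ∀ j, Commute b (a j)) (I : Fin n →₀ ℕ) :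
    Commute b (multiPow a I) := by
  refine Commute.list_prod_right _ _ fun x hx => ?_
  obtain ⟨j, -, rfl⟩ := List.mem_map.1 hx
  exact (hb j).pow_right _

theorem multiPow_add {a : Fin n → M} (ha : ∀ i j, Commute (a i) (a j)) (I J : Fin n →₀ ℕ) :
    multiPow a (I + J) = multiPow a I * multiPow a J := by
  unfold multiPow
  induction List.finRange n with
  | nil => simp
  | cons j l ih =>
    have hcomm : Commute (a j ^ J j) (l.map fun i => a i ^ I i).prod := by
      refine Commute.list_prod_right _ _ fun x hx => ?_
      obtain ⟨i, -, rfl⟩ := List.mem_map.1 hx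
      exact (ha j i).pow_pow _ _
    rw [List.map_cons, List.map_cons, List.map_cons, List.prod_cons, List.prod_cons,
      List.prod_cons, ih, Finsupp.add_apply, pow_add, mul_assoc, mul_assoc, hcomm.left_comm]

theorem multiPow_add_single {a : Fin n → M} (ha : ∀ i j, Commute (a i) (a j)) (I : Fin n →₀ ℕ)
    (j : Fin n) : multiPow a (I + Finsupp.single j 1) = a j * multiPow a I := by
  rw [multiPow_add ha, multiPow_single, pow_one, (commute_multiPow (ha j) I).eq]

theorem sum_antidiagonal_add_single {σ A : Type*} [DecidableEq σ] [AddCommMonoid A] (I : σ →₀ ℕ)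
    (j : σ) {φ : (σ →₀ ℕ) → (σ →₀ ℕ) → A} (hφ : ∀ K J, K j = 0 → φ K J = 0) :
    ∑ p ∈ antidiagonal (I + Finsupp.single j 1), φ p.1 p.2 =
      ∑ p ∈ antidiagonal I, φ (p.1 + Finsupp.single j 1) p.2 := by
  symm
  refine Finset.sum_of_injOn (fun p => (p.1 + Finsupp.single j 1, p.2)) ?_ ?_ ?_ fun _ _ => rfl
  · rintro ⟨K, J⟩ - ⟨K', J'⟩ - hp
    simpa using hp
  · rintro ⟨K, J⟩ hKJ
    rw [mem_coe, HasAntidiagonal.mem_antidiagonal] at hKJ ⊢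
    rw [← hKJ, add_right_comm]
  · rintro ⟨K, J⟩ hKJ hnot
    refine hφ K J (by_contra fun hK => hnot ?_)
    obtain ⟨K, rfl⟩ := exists_add_of_le (Finsupp.single_le_iff.2 (Nat.one_le_iff_ne_zero.2 hK))
    refine ⟨(K, J), ?_, by rw [add_comm]⟩
    rw [HasAntidiagonal.mem_antidiagonal, add_assoc, add_comm I, add_right_inj] at hKJ
    exact mem_coe.2 (HasAntidiagonal.mem_antidiagonal.2 hKJ)

variable {σ : Type*} [Fintype σ]

/-- The multi-index binomial coefficient `binom(J + K, J)`. -/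
def multiBinom (K J : σ →₀ ℕ) : ℕ := ∏ l, (J l + K l).choose (J l)

theorem multiBinom_eq_mul_prod_erase [DecidableEq σ] (j : σ) (K J : σ →₀ ℕ) :
    multiBinom K J =
      (J j + K j).choose (J j) * ∏ l ∈ univ.erase j, (J l + K l).choose (J l) :=
  (mul_prod_erase _ _ (mem_univ j)).symm

theorem multiBinom_eq_ite_add_ite {j : σ} {K J : σ →₀ ℕ} (hj : 0 < K j + J j) :
    multiBinom K J =
      (if K j = 0 then 0 else multiBinom (K - Finsupp.single j 1) J) +
        if J j = 0 then 0 else multiBinom K (J - Finsupp.single j 1) := by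
  classical
  have hsub (L : σ →₀ ℕ) {l : σ} (hl : l ∈ univ.erase j) :
      (L - Finsupp.single j 1 : σ →₀ ℕ) l = L l := by
    simp [Finsupp.single_eq_of_ne (ne_of_mem_erase hl)]
  have hprod_left : ∏ l ∈ univ.erase j, (J l + (K - Finsupp.single j 1 : σ →₀ ℕ) l).choose (J l) =
      ∏ l ∈ univ.erase j, (J l + K l).choose (J l) :=
    prod_congr rfl fun l hl => by rw [hsub K hl]
  have hprod_right : ∏ l ∈ univ.erase j, ((J - Finsupp.single j 1 : σ →₀ ℕ) l + K l).choose
      ((J - Finsupp.single j 1 : σ →₀ ℕ) l) = ∏ l ∈ univ.erase j, (J l + K l).choose (J l) :=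
    prod_congr rfl fun l hl => by rw [hsub J hl]
  simp only [multiBinom_eq_mul_prod_erase j, hprod_left, hprod_right]
  simp only [Finsupp.tsub_apply, Finsupp.single_eq_same]
  rcases hKj : K j with _ | a <;> rcases hJj : J j with _ | b
  · omega
  · simp
  · simp
  · have pascal : (b + 1 + (a + 1)).choose (b + 1) =
        (b + 1 + a).choose (b + 1) + (b + (a + 1)).choose b := by
      rw [← add_assoc, Nat.choose_succ_succ, add_comm, add_right_comm b 1 a, add_assoc b a 1]
    simp [pascal, add_mul]

theorem sum_antidiagonal_multiBinom_add_single [DecidableEq σ] {A : Type*} [AddCommMonoid A]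
    (I : σ →₀ ℕ) (j : σ) (φ : (σ →₀ ℕ) → (σ →₀ ℕ) → A) :
    ∑ p ∈ antidiagonal (I + Finsupp.single j 1), multiBinom p.1 p.2 • φ p.1 p.2 =
      ∑ p ∈ antidiagonal I, multiBinom p.1 p.2 •
        (φ (p.1 + Finsupp.single j 1) p.2 + φ p.1 (p.2 + Finsupp.single j 1)) := by
  have hpos {p : (σ →₀ ℕ) × (σ →₀ ℕ)} (hp : p ∈ antidiagonal (I + Finsupp.single j 1)) :
      0 < p.1 j + p.2 j := by
    rw [← Finsupp.add_apply, HasAntidiagonal.mem_antidiagonal.1 hp]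
    simp
  rw [sum_congr rfl fun p hp => by rw [multiBinom_eq_ite_add_ite (hpos hp), add_smul],
    sum_add_distrib]
  simp only [smul_add, sum_add_distrib]
  congr 1
  · rw [sum_antidiagonal_add_single I j
      (φ := fun K J => (if K j = 0 then 0 else multiBinom (K - Finsupp.single j 1) J) • φ K J)
      fun K J hK => by simp [hK]]
    simp
  · rw [Finsupp.sum_antidiagonal_swap _ fun K J =>
        (if J j = 0 then 0 else multiBinom K (J - Finsupp.single j 1)) • φ K J,
      sum_antidiagonal_add_single I j
        (φ := fun J K => (if J j = 0 then 0 else multiBinom K (J - Finsupp.single j 1)) • φ K J)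
        fun J K hJ => by simp [hJ],
      Finsupp.sum_antidiagonal_swap I fun K J =>
        multiBinom K J • φ K (J + Finsupp.single j 1)]
    simp

end MultiIndex

section Leibniz

open Finset

variable {k R : Type*} [CommRing k] [CommRing R] [Algebra k R]

theorem derivation_pow_mul (T : Derivation k R R) (s : ℕ) (a b : R) :
    ((T : Module.End k R) ^ s) (a * b) = ∑ p ∈ antidiagonal s,
      s.choose p.1 • (((T : Module.End k R) ^ p.1) a * ((T : Module.End k R) ^ p.2) b) := by
  induction s with
  | zero => simp
  | succ s ih =>
    rw [sum_antidiagonal_choose_succ_nsmul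
        (M := R) (fun i j => ((T : Module.End k R) ^ i) a * ((T : Module.End k R) ^ j) b) s,
      pow_succ', Module.End.mul_apply, ih, map_sum, ← sum_add_distrib]
    refine sum_congr rfl fun p hp => ?_
    rw [← Nat.choose_symm_of_eq_add (HasAntidiagonal.mem_antidiagonal.1 hp).symm, map_nsmul,
      ← smul_add]
    simp [pow_succ', mul_comm]

/-- The monomial `D_1 ^ I_1 ⋯ D_n ^ I_n` in the derivations `D_j`, as an operator. -/
def derivPow (D : Fin n → Derivation k R R) (I : Fin n →₀ ℕ) : Module.End k R :=
  multiPow (fun j => (D j : Module.End k R)) I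

variable {D : Fin n → Derivation k R R}

@[simp]
theorem derivPow_zero : derivPow D 0 = 1 := multiPow_zero _

theorem derivPow_add_single (hD : ∀ i j, Commute (D i : Module.End k R) (D j)) (I : Fin n →₀ ℕ)
    (j : Fin n) : derivPow D (I + Finsupp.single j 1) = D j * derivPow D I :=
  multiPow_add_single hD I j

theorem derivPow_mul (hD : ∀ i j, Commute (D i : Module.End k R) (D j)) (I : Fin n →₀ ℕ)
    (a b : R) :
    derivPow D I (a * b) = ∑ p ∈ antidiagonal I,
      multiBinom p.1 p.2 • (derivPow D p.1 a * derivPow D p.2 b) := by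
  induction I using finsupp_nat_induction with
  | zero => simp [multiBinom]
  | add_single I j ih =>
    rw [sum_antidiagonal_multiBinom_add_single I j fun K J => derivPow D K a * derivPow D J b,
      derivPow_add_single hD, Module.End.mul_apply, ih, map_sum]
    refine sum_congr rfl fun p _ => ?_
    simp [derivPow_add_single hD, mul_comm, add_comm, mul_add]

theorem commute_neg_derivation (hD : ∀ i j, Commute (D i : Module.End k R) (D j)) (i j : Fin n) :
    Commute ((-D) i : Module.End k R) ((-D) j) :=
  (hD i j).neg_left.neg_right

theorem derivPow_neg_apply (hD : ∀ i j, Commute (D i : Module.End k R) (D j)) (I : Fin n →₀ ℕ)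
    (f : R) : derivPow (-D) I f = (-1) ^ I.degree * derivPow D I f := by
  induction I using finsupp_nat_induction with
  | zero => simp
  | add_single I j ih =>
    rw [derivPow_add_single (commute_neg_derivation hD), derivPow_add_single hD, map_add,
      Finsupp.degree_single, pow_succ, Module.End.mul_apply, ih]
    obtain hI | hI := I.degree.even_or_odd <;> simp [hI.neg_one_pow]

theorem commute_derivPow {T : Module.End k R} (hT : ∀ j, Commute T (D j)) (I : Fin n →₀ ℕ) :
    Commute T (derivPow D I) :=
  commute_multiPow hT I

end Leibniz

section CoordAlgebra

/-- A commutative algebra of functions in the coordinates `coord c`, `c : ι`, each of which has only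
finitely many nonzero partial derivatives `grad f c = ∂f/∂c`. -/
structure CoordAlgebra (k ι R : Type*) [CommRing k] [CommRing R] [Algebra k R] where
  grad : Derivation k R (ι →₀ R)
  coord : ι → R
  grad_coord : ∀ c, grad (coord c) = Finsupp.single c 1
  grad_grad_comm : ∀ c c' f, grad (grad f c) c' = grad (grad f c') c

namespace CoordAlgebra

variable {k ι R : Type*} [CommRing k] [CommRing R] [Algebra k R] (C : CoordAlgebra k ι R)

/-- The vector field `∑_c a_c ∂/∂c`. -/
def vectorField (a : ι → R) : Derivation k R R :=
  (Finsupp.linearCombination R a).compDer C.grad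

theorem vectorField_apply (a : ι → R) (f : R) :
    C.vectorField a f = Finsupp.linearCombination R a (C.grad f) := rfl

theorem vectorField_coord (a : ι → R) (c : ι) : C.vectorField a (C.coord c) = a c := by
  simp [vectorField_apply, C.grad_coord]

theorem support_grad_grad_subset (f : R) (c : ι) :
    (C.grad (C.grad f c)).support ⊆ (C.grad f).support := by
  intro c' hc'
  contrapose! hc'
  rw [Finsupp.notMem_support_iff] at hc' ⊢
  rw [C.grad_grad_comm, hc', map_zero, Finsupp.zero_apply]

theorem grad_vectorField (a : ι → R) (f : R) :
    C.grad (C.vectorField a f) = (C.grad f).mapRange (C.vectorField a) (map_zero _) +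
      Finsupp.linearCombination R (fun c => C.grad (a c)) (C.grad f) := by
  ext c
  have hfield : C.vectorField a (C.grad f c) =
      ∑ c' ∈ (C.grad f).support, C.grad (C.grad f c) c' * a c' :=
    Finsupp.sum_of_support_subset _ (C.support_grad_grad_subset f c) _ (by simp)
  simp only [Finsupp.add_apply, Finsupp.mapRange_apply, hfield]
  simp only [vectorField_apply, Finsupp.linearCombination_apply, Finsupp.sum, map_sum, smul_eq_mul,
    Derivation.leibniz, Finsupp.coe_finsetSum, Finset.sum_apply, Finsupp.add_apply,
    Finsupp.smul_apply, Finset.sum_add_distrib, C.grad_grad_comm c]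
  rw [add_comm]
  simp only [mul_comm]

theorem vectorField_vectorField (a b : ι → R) (f : R) :
    C.vectorField a (C.vectorField b f) =
      Finsupp.linearCombination R a ((C.grad f).mapRange (C.vectorField b) (map_zero _)) +
        Finsupp.linearCombination R (fun c => C.vectorField a (b c)) (C.grad f) := by
  rw [C.vectorField_apply a, grad_vectorField, map_add]
  congr 1
  induction C.grad f using Finsupp.induction_linear with
  | zero => simp
  | add g g' hg hg' => simp only [map_add, hg, hg']
  | single c r => simp [vectorField_apply]

theorem vectorField_vectorField' (a b : ι → R) (f : R) :
    C.vectorField a (C.vectorField b f) =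
      Finsupp.linearCombination R b ((C.grad f).mapRange (C.vectorField a) (map_zero _)) +
        Finsupp.linearCombination R (fun c => C.vectorField a (b c)) (C.grad f) := by
  rw [C.vectorField_apply b]
  induction C.grad f using Finsupp.induction_linear with
  | zero => simp
  | add g g' hg hg' =>
    rw [map_add, map_add, hg, hg', Finsupp.mapRange_add (fun x y => map_add _ x y), map_add,
      map_add, add_add_add_comm]
  | single c r => simp [mul_comm, add_comm]

theorem commute_vectorField {a b : ι → R}
    (hcoord : ∀ c, C.vectorField a (C.vectorField b (C.coord c)) =
      C.vectorField b (C.vectorField a (C.coord c))) :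
    Commute (C.vectorField a : Module.End k R) (C.vectorField b) :=
  LinearMap.ext fun f => by
    simp only [vectorField_coord] at hcoord
    simp only [Module.End.mul_apply, Derivation.coeFn_coe]
    rw [vectorField_vectorField, vectorField_vectorField' C b a]
    simp only [hcoord]

end CoordAlgebra

end CoordAlgebra

section TotalDerivatives

namespace CoordAlgebra

variable {k R : Type*} [CommRing k] [CommRing R] [Algebra k R]
  (C : CoordAlgebra k (Coord n m h) R) (F : Fin m → R)

/-- The total derivative with respect to `x_j` on an algebra of functions of the jet coordinates. -/
def totalDx (j : Fin n) : Derivation k R R :=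
  C.vectorField fun
    | .t => 0
    | .x i => if i = j then 1 else 0
    | .u i s I => C.coord (.u i s (I + Finsupp.single j 1))

@[simp]
theorem totalDx_coord_t (j : Fin n) : C.totalDx j (C.coord .t) = 0 := C.vectorField_coord _ _

@[simp]
theorem totalDx_coord_x (i j : Fin n) : C.totalDx j (C.coord (.x i)) = if i = j then 1 else 0 :=
  C.vectorField_coord _ _

@[simp]
theorem totalDx_coord_u (j : Fin n) (i : Fin m) (s : Fin h) (I : Fin n →₀ ℕ) :
    C.totalDx j (C.coord (.u i s I)) = C.coord (.u i s (I + Finsupp.single j 1)) :=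
  C.vectorField_coord _ _

theorem commute_totalDx (i j : Fin n) :
    Commute (C.totalDx i : Module.End k R) (C.totalDx j) := by
  refine C.commute_vectorField fun c => ?_
  change C.totalDx i (C.totalDx j _) = C.totalDx j (C.totalDx i _)
  rcases c with _ | l | ⟨l, s, I⟩
  · simp
  · simp [apply_ite]
  · simp [add_right_comm]

/-- The total derivative with respect to `t`, restricted to the system with right-hand sides `F`. -/
def totalDt : Derivation k R R :=
  C.vectorField fun
    | .t => 1
    | .x _ => 0
    | .u i s I =>
      if hs : (s : ℕ) + 1 < h then C.coord (.u i ⟨s + 1, hs⟩ I) else derivPow C.totalDx I (F i)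

@[simp]
theorem totalDt_coord_t : C.totalDt F (C.coord .t) = 1 := C.vectorField_coord _ _

@[simp]
theorem totalDt_coord_x (j : Fin n) : C.totalDt F (C.coord (.x j)) = 0 := C.vectorField_coord _ _

@[simp]
theorem totalDt_coord_u (i : Fin m) (s : Fin h) (I : Fin n →₀ ℕ) :
    C.totalDt F (C.coord (.u i s I)) =
      if hs : (s : ℕ) + 1 < h then C.coord (.u i ⟨s + 1, hs⟩ I) else derivPow C.totalDx I (F i) :=
  C.vectorField_coord _ _

theorem commute_totalDt_totalDx (j : Fin n) :
    Commute (C.totalDt F : Module.End k R) (C.totalDx j) := by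
  refine C.commute_vectorField fun c => ?_
  change C.totalDt F (C.totalDx j _) = C.totalDx j (C.totalDt F _)
  rcases c with _ | l | ⟨l, s, I⟩
  · simp
  · simp [apply_ite]
  · rw [totalDx_coord_u, totalDt_coord_u, totalDt_coord_u]
    split_ifs
    · rw [totalDx_coord_u]
    · rw [derivPow_add_single C.commute_totalDx, Module.End.mul_apply, Derivation.coeFn_coe]

end CoordAlgebra

end TotalDerivatives

section Coeffwise

open MvPolynomial

variable {σ k R : Type*} [CommRing k] [CommRing R] [Algebra k R]

/-- The action of an operator on the coefficients of a polynomial. -/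
def coeffwise (T : Module.End k R) : MvPolynomial σ R →ₗ[k] MvPolynomial σ R :=
  (AddMonoidAlgebra.coeffLinearEquiv k).symm.toLinearMap ∘ₗ
    Finsupp.mapRange.linearMap T ∘ₗ (AddMonoidAlgebra.coeffLinearEquiv k).toLinearMap

@[simp]
theorem coeff_coeffwise (T : Module.End k R) (I : σ →₀ ℕ) (p : MvPolynomial σ R) :
    coeff I (coeffwise T p) = T (coeff I p) := rfl

@[simp]
theorem coeffwise_monomial (T : Module.End k R) (I : σ →₀ ℕ) (b : R) :
    coeffwise T (monomial I b) = monomial I (T b) := by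
  classical
  ext J
  simp only [coeff_coeffwise, coeff_monomial, apply_ite T, map_zero]

end Coeffwise

section Linearization

open MvPolynomial

/-- The linear functional on differentials that extracts the operator
`∑_I (∂f/∂u^i_{s,I}) q^I` from the differential of `f`, `q_j` standing for `D_{x_j}`. -/
def operatorPart (R : Type*) [CommRing R] (i : Fin m) (s : ℕ) :
    (Coord n m h →₀ R) →ₗ[R] MvPolynomial (Fin n) R :=
  Finsupp.linearCombination R fun
    | .t => 0
    | .x _ => 0
    | .u i' s' I => if i' = i ∧ (s' : ℕ) = s then monomial I 1 else 0

section operatorPart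

variable {R : Type*} [CommRing R]

theorem operatorPart_single_t (i : Fin m) (s : ℕ) (r : R) :
    operatorPart R i s (Finsupp.single (.t : Coord n m h) r) = 0 := by
  simp [operatorPart]

theorem operatorPart_single_x (i : Fin m) (s : ℕ) (j : Fin n) (r : R) :
    operatorPart R i s (Finsupp.single (.x j : Coord n m h) r) = 0 := by
  simp [operatorPart]

theorem operatorPart_single_u (i : Fin m) (s : ℕ) (i' : Fin m) (s' : Fin h) (I : Fin n →₀ ℕ)
    (r : R) : operatorPart R i s (Finsupp.single (.u i' s' I) r) =
      if i' = i ∧ (s' : ℕ) = s then monomial I r else 0 := by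
  simp [operatorPart, smul_monomial]

theorem coeff_operatorPart (i : Fin m) (s : Fin h) (I : Fin n →₀ ℕ) (g : Coord n m h →₀ R) :
    coeff I (operatorPart R i s g) = g (.u i s I) := by
  induction g using Finsupp.induction_linear with
  | zero => simp
  | add g g' hg hg' => simp only [map_add, coeff_add, Finsupp.add_apply, hg, hg']
  | single c r =>
    rcases c with _ | j | ⟨i', s', I'⟩
    · simp [operatorPart_single_t]
    · simp [operatorPart_single_x]
    · rw [operatorPart_single_u, Finsupp.single_apply, apply_ite (coeff I), coeff_monomial,
        coeff_zero, ← ite_and]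
      simp only [Coord.u.injEq, Fin.val_inj, and_assoc]

end operatorPart

namespace CoordAlgebra

variable {k R : Type*} [CommRing k] [CommRing R] [Algebra k R]
  (C : CoordAlgebra k (Coord n m h) R) (F : Fin m → R)

/-- The part `∑_I (∂f/∂u^i_{s,I}) q^I` of the linearization of `f`, with `q_j` standing for the
total derivative in `x_j`. It is zero for `s ≥ h`. -/
def lin (i : Fin m) (s : ℕ) : Derivation k R (MvPolynomial (Fin n) R) :=
  (operatorPart R i s).compDer C.grad

theorem lin_apply (i : Fin m) (s : ℕ) (f : R) : C.lin i s f = operatorPart R i s (C.grad f) := rfl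

theorem coeff_lin (i : Fin m) (s : Fin h) (I : Fin n →₀ ℕ) (f : R) :
    coeff I (C.lin i s f) = C.grad f (.u i s I) :=
  coeff_operatorPart i s I _

theorem operatorPart_mapRange (i : Fin m) (s : ℕ) (T : Derivation k R R) (g : Coord n m h →₀ R) :
    operatorPart R i s (g.mapRange T (map_zero T)) =
      coeffwise (T : Module.End k R) (operatorPart R i s g) := by
  induction g using Finsupp.induction_linear with
  | zero => simp
  | add g g' hg hg' =>
    rw [Finsupp.mapRange_add (fun x y => map_add T x y), map_add, map_add, map_add, hg, hg']
  | single c r =>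
    rcases c with _ | j | ⟨i', s', I⟩
    · simp [operatorPart_single_t]
    · simp [operatorPart_single_x]
    · simp only [Finsupp.mapRange_single, operatorPart_single_u, apply_ite (coeffwise _),
        coeffwise_monomial, map_zero, Derivation.coeFn_coe]

theorem lin_totalDx (i : Fin m) (s : ℕ) (j : Fin n) (f : R) :
    C.lin i s (C.totalDx j f) =
      coeffwise (C.totalDx j : Module.End k R) (C.lin i s f) + X j * C.lin i s f := by
  rw [lin_apply, totalDx, grad_vectorField, map_add, operatorPart_mapRange, lin_apply]
  congr 1
  induction C.grad f using Finsupp.induction_linear with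
  | zero => simp
  | add g g' hg hg' => simp only [map_add, mul_add, hg, hg']
  | single c r =>
    rcases c with _ | l | ⟨l, s', I⟩
    · simp [operatorPart_single_t]
    · simp [operatorPart_single_x, apply_ite C.grad]
    · simp [operatorPart_single_u, C.grad_coord, X, monomial_mul, add_comm]

/-- The `R`-linear map `q^I ↦ lin i s (D_x^I G)`, that is, composition with the linearization
of `G`. -/
def linComp (i : Fin m) (s : ℕ) (G : R) : MvPolynomial (Fin n) R →ₗ[R] MvPolynomial (Fin n) R :=
  (basisMonomials (Fin n) R).constr R fun I => C.lin i s (derivPow C.totalDx I G)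

theorem linComp_monomial (i : Fin m) (s : ℕ) (G : R) (I : Fin n →₀ ℕ) (b : R) :
    C.linComp i s G (monomial I b) = b • C.lin i s (derivPow C.totalDx I G) := by
  have hone : C.linComp i s G (monomial I 1) = C.lin i s (derivPow C.totalDx I G) := by
    simpa only [linComp, coe_basisMonomials] using (basisMonomials (Fin n) R).constr_basis R _ I
  rw [← hone, ← map_smul, smul_monomial, smul_eq_mul, mul_one]

theorem lin_totalDt (i : Fin m) {s : ℕ} (hs : s < h) (f : R) :
    C.lin i s (C.totalDt F f) = coeffwise (C.totalDt F : Module.End k R) (C.lin i s f) +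
      ((if s = 0 then 0 else C.lin i (s - 1) f) +
        ∑ l, C.linComp i s (F l) (C.lin l (h - 1) f)) := by
  rw [lin_apply, totalDt, grad_vectorField, map_add, operatorPart_mapRange]
  congr 1
  simp only [lin_apply]
  induction C.grad f using Finsupp.induction_linear with
  | zero => simp
  | add g g' hg hg' =>
    simp only [map_add, hg, hg', Finset.sum_add_distrib]
    split_ifs
    · abel
    · abel
  | single c r =>
    rcases c with _ | l | ⟨l, s', I⟩
    · simp [operatorPart_single_t]
    · simp [operatorPart_single_x]
    · simp only [operatorPart_single_u, Finsupp.linearCombination_single, map_smul]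
      by_cases hs' : (s' : ℕ) + 1 < h
      · have hlast : (s' : ℕ) ≠ h - 1 := by omega
        have hprev : (s' : ℕ) + 1 = s ↔ s ≠ 0 ∧ (s' : ℕ) = s - 1 := by omega
        simp only [hs', hlast, hprev, dif_pos, C.grad_coord, operatorPart_single_u, and_false,
          if_false, map_zero, Finset.sum_const_zero, add_zero, smul_ite, smul_monomial, smul_zero,
          smul_eq_mul, mul_one]
        split_ifs <;> tauto
      · have hprev : (if s = 0 then 0 else if l = i ∧ (s' : ℕ) = s - 1 then monomial I r else 0) =
            (0 : MvPolynomial (Fin n) R) := by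
          split_ifs <;> first | rfl | omega
        have hlast : (s' : ℕ) = h - 1 := by omega
        rw [hprev, zero_add]
        simp only [dif_neg hs']
        simp only [hlast, and_true, apply_ite (C.linComp _ _ _), map_zero, linComp_monomial,
          Finset.sum_ite_eq, Finset.mem_univ, if_true, lin_apply]

end CoordAlgebra

end Linearization

section FormalAdjoint

open MvPolynomial

variable {k R : Type*} [CommRing k] [CommRing R] [Algebra k R] {D : Fin n → Derivation k R R}

theorem lmul_derivation (T : Derivation k R R) (b : R) :
    Algebra.lmul k R (T b) = T * Algebra.lmul k R b - Algebra.lmul k R b * T := by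
  ext f
  simp [mul_comm]

/-- The formal adjoint `∑_I (-D)^I ∘ a_I` of the differential operator `∑_I a_I D^I`, which is
encoded as the polynomial `∑_I a_I q^I`. -/
def formalAdjoint (D : Fin n → Derivation k R R) :
    MvPolynomial (Fin n) R →ₗ[k] Module.End k R :=
  Finsupp.lsum k
      (fun I => LinearMap.mulLeft k (derivPow (-D) I) ∘ₗ (Algebra.lmul k R).toLinearMap) ∘ₗ
    (AddMonoidAlgebra.coeffLinearEquiv k).toLinearMap

theorem formalAdjoint_monomial (I : Fin n →₀ ℕ) (b : R) :
    formalAdjoint D (monomial I b) = derivPow (-D) I * Algebra.lmul k R b := by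
  simp only [formalAdjoint, LinearMap.comp_apply]
  exact Finsupp.lsum_single ..

theorem formalAdjoint_C (b f : R) : formalAdjoint D (C b) f = b * f := by
  rw [C_apply, formalAdjoint_monomial, derivPow_zero]
  rfl

theorem formalAdjoint_smul (b : R) (p : MvPolynomial (Fin n) R) :
    formalAdjoint D (b • p) = formalAdjoint D p * Algebra.lmul k R b := by
  induction p using MvPolynomial.induction_on' with
  | monomial I a =>
    rw [smul_monomial, smul_eq_mul, mul_comm, formalAdjoint_monomial, formalAdjoint_monomial,
      map_mul, mul_assoc]
  | add p q hp hq => rw [smul_add, map_add, map_add, hp, hq, add_mul]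

theorem formalAdjoint_coeffwise {T : Derivation k R R}
    (hT : ∀ j, Commute (T : Module.End k R) (D j)) (p : MvPolynomial (Fin n) R) :
    formalAdjoint D (coeffwise (T : Module.End k R) p) =
      T * formalAdjoint D p - formalAdjoint D p * T := by
  have hneg (j : Fin n) : Commute (T : Module.End k R) ((-D) j) := (hT j).neg_right
  induction p using MvPolynomial.induction_on' with
  | monomial I b =>
    rw [coeffwise_monomial, formalAdjoint_monomial, formalAdjoint_monomial,
      Derivation.coeFn_coe, lmul_derivation, mul_sub, ← mul_assoc, ← mul_assoc, ← mul_assoc,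
      (commute_derivPow hneg I).eq]
  | add p q hp hq => rw [map_add, map_add, map_add, hp, hq]; noncomm_ring

theorem formalAdjoint_X_mul (hD : ∀ i j, Commute (D i : Module.End k R) (D j)) (j : Fin n)
    (p : MvPolynomial (Fin n) R) : formalAdjoint D (X j * p) = (-D) j * formalAdjoint D p := by
  induction p using MvPolynomial.induction_on' with
  | monomial I b =>
    rw [X, monomial_mul, one_mul, add_comm, formalAdjoint_monomial, formalAdjoint_monomial,
      derivPow_add_single (commute_neg_derivation hD), mul_assoc]
  | add p q hp hq => rw [mul_add, map_add, map_add, hp, hq, mul_add]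

/-- The multi-indices of degree at most `N`. -/
def multiIndicesLE (n N : ℕ) : Finset (Fin n →₀ ℕ) :=
  (Finsupp.finite_of_degree_le N).toFinset

@[simp]
theorem mem_multiIndicesLE {N : ℕ} {I : Fin n →₀ ℕ} : I ∈ multiIndicesLE n N ↔ I.degree ≤ N :=
  Set.Finite.mem_toFinset _

theorem coeff_eq_zero_of_notMem_multiIndicesLE {N : ℕ} {p : MvPolynomial (Fin n) R}
    (hp : p.totalDegree ≤ N) {I : Fin n →₀ ℕ} (hI : I ∉ multiIndicesLE n N) : coeff I p = 0 := by
  rw [mem_multiIndicesLE, not_le] at hI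
  exact coeff_eq_zero_of_totalDegree_lt (hp.trans_lt hI)

theorem coeff_add_eq_zero_of_notMem_multiIndicesLE {N : ℕ} {p : MvPolynomial (Fin n) R}
    (hp : p.totalDegree ≤ N) {K : Fin n →₀ ℕ} (hK : K ∉ multiIndicesLE n N) (J : Fin n →₀ ℕ) :
    coeff (J + K) p = 0 := by
  refine coeff_eq_zero_of_notMem_multiIndicesLE hp fun hJK => hK ?_
  rw [mem_multiIndicesLE] at hJK ⊢
  exact (Finsupp.degree_mono (by simp)).trans hJK

theorem formalAdjoint_apply (hD : ∀ i j, Commute (D i : Module.End k R) (D j)) {N : ℕ}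
    {p : MvPolynomial (Fin n) R} (hp : p.totalDegree ≤ N) (f : R) :
    formalAdjoint D p f =
      ∑ I ∈ multiIndicesLE n N, (-1) ^ I.degree * derivPow D I (coeff I p * f) := by
  have hsum : p = ∑ I ∈ multiIndicesLE n N, monomial I (coeff I p) :=
    p.as_sum.trans <| Finset.sum_subset
      (fun I hI => mem_multiIndicesLE.2 ((le_totalDegree hI).trans hp))
      fun I _ hI => by rw [notMem_support_iff.1 hI, monomial_zero]
  conv_lhs => rw [hsum]
  simp only [map_sum, formalAdjoint_monomial, LinearMap.sum_apply, Module.End.mul_apply,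
    derivPow_neg_apply hD]
  rfl

/-- The coefficient of `D^J` in the formal adjoint, given by the Leibniz rule. -/
def adjointCoeff (D : Fin n → Derivation k R R) (J : Fin n →₀ ℕ) (p : MvPolynomial (Fin n) R) : R :=
  ∑ᶠ K, (-1) ^ (J + K).degree * (multiBinom K J * derivPow D K (coeff (J + K) p))

theorem adjointCoeff_eq_sum {N : ℕ} {p : MvPolynomial (Fin n) R} (hp : p.totalDegree ≤ N)
    (J : Fin n →₀ ℕ) :
    adjointCoeff D J p = ∑ K ∈ multiIndicesLE n N,
      (-1) ^ (J + K).degree * (multiBinom K J * derivPow D K (coeff (J + K) p)) := by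
  refine finsum_eq_sum_of_support_subset _ (Function.support_subset_iff'.2 fun K hK => ?_)
  rw [coeff_add_eq_zero_of_notMem_multiIndicesLE hp hK, map_zero, mul_zero, mul_zero]

theorem formalAdjoint_eq_sum (hD : ∀ i j, Commute (D i : Module.End k R) (D j)) {N : ℕ}
    {p : MvPolynomial (Fin n) R} (hp : p.totalDegree ≤ N) (f : R) :
    formalAdjoint D p f = ∑ J ∈ multiIndicesLE n N, adjointCoeff D J p * derivPow D J f := by
  set S := multiIndicesLE n N
  set g : (Fin n →₀ ℕ) × (Fin n →₀ ℕ) → R := fun q => (-1) ^ (q.2 + q.1).degree *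
    (multiBinom q.1 q.2 * derivPow D q.1 (coeff (q.2 + q.1) p)) * derivPow D q.2 f with hg
  have hg_zero {q} (hq : q.1 + q.2 ∉ S) : g q = 0 := by
    simp [hg, coeff_eq_zero_of_notMem_multiIndicesLE hp (add_comm q.1 q.2 ▸ hq)]
  have hfiber {I} (hI : I ∈ S) :
      {q ∈ {q ∈ S ×ˢ S | q.1 + q.2 ∈ S} | q.1 + q.2 = I} =
        Finset.HasAntidiagonal.antidiagonal I := by
    ext q
    have hparts : q.1 + q.2 = I → q.1 ∈ S ∧ q.2 ∈ S := by
      rintro rfl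
      simp only [S, mem_multiIndicesLE, map_add] at hI ⊢
      omega
    simp only [Finset.mem_filter, Finset.mem_product, Finset.HasAntidiagonal.mem_antidiagonal]
    grind
  calc formalAdjoint D p f
      = ∑ I ∈ S, ∑ q ∈ Finset.HasAntidiagonal.antidiagonal I, g q := by
        rw [formalAdjoint_apply hD hp]
        refine Finset.sum_congr rfl fun I _ => ?_
        rw [derivPow_mul hD, Finset.mul_sum]
        refine Finset.sum_congr rfl fun q hq => ?_
        rw [← Finset.HasAntidiagonal.mem_antidiagonal.1 hq, add_comm q.1, nsmul_eq_mul]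
        simp only [hg]
        ring
    _ = ∑ q ∈ S ×ˢ S with q.1 + q.2 ∈ S, g q := by
        rw [← Finset.sum_fiberwise_of_maps_to fun q hq => (Finset.mem_filter.1 hq).2]
        exact Finset.sum_congr rfl fun I hI => by rw [hfiber hI]
    _ = ∑ q ∈ S ×ˢ S, g q := Finset.sum_filter_of_ne fun q _ hq => by_contra fun h => hq (hg_zero h)
    _ = ∑ J ∈ S, adjointCoeff D J p * derivPow D J f := by
        rw [Finset.sum_product_right]
        simp only [adjointCoeff_eq_sum hp, Finset.sum_mul, hg, S]

end FormalAdjoint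

section AdjointEquation

open MvPolynomial

theorem pow_apply_eq_add_sum_range {k M : Type*} [Semiring k] [AddCommMonoid M] [Module k M]
    (T : Module.End k M) {q a : ℕ → M} {r : ℕ} (hq : ∀ s < r, T (q (s + 1)) = q s + a s) :
    (T ^ r) (q r) = q 0 + ∑ s ∈ Finset.range r, (T ^ s) (a s) := by
  induction r with
  | zero => simp
  | succ r ih =>
    rw [pow_succ, Module.End.mul_apply, hq r r.lt_succ_self, map_add,
      ih fun s hs => hq s (hs.trans r.lt_succ_self), Finset.sum_range_succ, add_assoc]

namespace CoordAlgebra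

variable {k R : Type*} [CommRing k] [CommRing R] [Algebra k R]
  (C : CoordAlgebra k (Coord n m h) R) (F : Fin m → R)

theorem formalAdjoint_lin_totalDx (i : Fin m) (s : ℕ) (j : Fin n) (f : R) :
    formalAdjoint C.totalDx (C.lin i s (C.totalDx j f)) =
      formalAdjoint C.totalDx (C.lin i s f) * (-C.totalDx) j := by
  rw [lin_totalDx, map_add, formalAdjoint_coeffwise (C.commute_totalDx j),
    formalAdjoint_X_mul C.commute_totalDx]
  ext g
  simp only [LinearMap.add_apply, LinearMap.sub_apply, Module.End.mul_apply, Derivation.coeFn_coe,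
    Pi.neg_apply, Derivation.neg_apply, map_neg]
  abel

theorem formalAdjoint_lin_derivPow (i : Fin m) (s : ℕ) (I : Fin n →₀ ℕ) (f : R) :
    formalAdjoint C.totalDx (C.lin i s (derivPow C.totalDx I f)) =
      formalAdjoint C.totalDx (C.lin i s f) * derivPow (-C.totalDx) I := by
  have hneg := commute_neg_derivation C.commute_totalDx
  induction I using finsupp_nat_induction with
  | zero => simp
  | add_single I j ih =>
    rw [derivPow_add_single C.commute_totalDx, Module.End.mul_apply, Derivation.coeFn_coe,
      formalAdjoint_lin_totalDx, ih, mul_assoc, derivPow_add_single hneg,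
      (commute_derivPow (hneg j) I).eq]

theorem formalAdjoint_linComp (i : Fin m) (s : ℕ) (G : R) (p : MvPolynomial (Fin n) R) :
    formalAdjoint C.totalDx (C.linComp i s G p) =
      formalAdjoint C.totalDx (C.lin i s G) * formalAdjoint C.totalDx p := by
  induction p using MvPolynomial.induction_on' with
  | monomial I b =>
    rw [linComp_monomial, formalAdjoint_smul, formalAdjoint_lin_derivPow, formalAdjoint_monomial,
      mul_assoc]
  | add p q hp hq => rw [map_add, map_add, map_add, hp, hq, mul_add]

/-- The Euler operator `f ↦ ∑_I (-D_x)^I (∂f/∂u^i_{s,I})`. -/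
def euler (i : Fin m) (s : ℕ) (f : R) : R := formalAdjoint C.totalDx (C.lin i s f) 1

theorem euler_sum_totalDx (i : Fin m) (s : ℕ) (f : Fin n → R) :
    C.euler i s (∑ j, C.totalDx j (f j)) = 0 := by
  simp [euler, formalAdjoint_lin_totalDx]

theorem euler_totalDt (i : Fin m) {s : ℕ} (hs : s < h) (f : R) :
    C.euler i s (C.totalDt F f) = C.totalDt F (C.euler i s f) +
      ((if s = 0 then 0 else C.euler i (s - 1) f) +
        ∑ l, formalAdjoint C.totalDx (C.lin i s (F l)) (C.euler l (h - 1) f)) := by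
  rw [euler, lin_totalDt _ _ _ hs]
  simp only [map_add, map_sum, apply_ite (formalAdjoint _), map_zero, formalAdjoint_linComp,
    formalAdjoint_coeffwise (C.commute_totalDt_totalDx F), LinearMap.add_apply,
    LinearMap.sub_apply, LinearMap.sum_apply, Module.End.mul_apply, Derivation.coeFn_coe,
    Derivation.map_one_eq_zero, map_zero, sub_zero]
  split_ifs <;> rfl

/- This is the adjoint linearized equation for the characteristic `χ_i = euler i (h - 1) f` of a
conservation law with density `f`. -/
theorem neg_totalDt_pow_euler (hh : 0 < h) {f : R} {g : Fin n → R}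
    (hfg : C.totalDt F f = ∑ j, C.totalDx j (g j)) (i : Fin m) :
    (((-C.totalDt F : Derivation k R R) : Module.End k R) ^ h) (C.euler i (h - 1) f) =
      ∑ s ∈ Finset.range h, (((-C.totalDt F : Derivation k R R) : Module.End k R) ^ s)
        (∑ l, formalAdjoint C.totalDx (C.lin i s (F l)) (C.euler l (h - 1) f)) := by
  have hstep : ∀ s < h, (-C.totalDt F) (C.euler i s f) =
      (if s = 0 then 0 else C.euler i (s - 1) f) +
        ∑ l, formalAdjoint C.totalDx (C.lin i s (F l)) (C.euler l (h - 1) f) := by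
    intro s hs
    have hzero := C.euler_totalDt F i hs f
    rw [hfg, euler_sum_totalDx] at hzero
    rw [Derivation.neg_apply, neg_eq_iff_add_eq_zero, ← hzero]
  have htel := pow_apply_eq_add_sum_range ((-C.totalDt F : Derivation k R R) : Module.End k R)
    (q := fun s => if s = 0 then 0 else C.euler i (s - 1) f) (r := h) hstep
  simpa [hh.ne'] using htel

end CoordAlgebra

end AdjointEquation

section NormalForm

variable {k R : Type*} [CommRing k] [CommRing R] [Algebra k R]

theorem neg_derivation_pow_apply (T : Derivation k R R) (s : ℕ) (f : R) :
    (((-T : Derivation k R R) : Module.End k R) ^ s) f =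
      (-1) ^ s * ((T : Module.End k R) ^ s) f := by
  induction s with
  | zero => simp
  | succ s ih =>
    rw [pow_succ', pow_succ' (T : Module.End k R), Module.End.mul_apply, ih]
    obtain hs | hs := s.even_or_odd <;> simp [pow_succ, hs.neg_one_pow]

/-- The coefficient of `T^r` in `∑_{s < h} (-T)^s ∘ a_s`. -/
def timeCoeff (h : ℕ) (T : Derivation k R R) (a : ℕ → R) (r : ℕ) : R :=
  ∑ s ∈ Finset.range h,
    if r ≤ s then (-1) ^ s * s.choose r * ((T : Module.End k R) ^ (s - r)) (a s) else 0

theorem sum_neg_derivation_pow_mul (h : ℕ) (T : Derivation k R R) (a : ℕ → R) (f : R) :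
    ∑ s ∈ Finset.range h, (((-T : Derivation k R R) : Module.End k R) ^ s) (a s * f) =
      ∑ r ∈ Finset.range h, timeCoeff h T a r * ((T : Module.End k R) ^ r) f := by
  simp only [timeCoeff, Finset.sum_mul]
  rw [Finset.sum_comm]
  refine Finset.sum_congr rfl fun s hs => ?_
  have hfilter : {r ∈ Finset.range h | r ≤ s} = Finset.range (s + 1) := by
    ext r
    simp only [Finset.mem_filter, Finset.mem_range] at hs ⊢
    omega
  simp only [ite_mul, zero_mul]
  rw [← Finset.sum_filter, hfilter, neg_derivation_pow_apply, mul_comm (a s), derivation_pow_mul,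
    Finset.Nat.sum_antidiagonal_eq_sum_range_succ_mk, Finset.mul_sum]
  refine Finset.sum_congr rfl fun r _ => ?_
  rw [nsmul_eq_mul]
  ring

open MvPolynomial

namespace CoordAlgebra

variable (C : CoordAlgebra k (Coord n m h) R) (F : Fin m → R)

/-- The coefficient of `D_t^r` in the operator `∑_s (-D_t)^s ∘ (lin i s G)^*`, provided that
`∂G/∂u^i_{s,I} = 0` for `s > 0` and `I ≠ 0`. The term with `s = 0` is left to `adjointCoeffX`. -/
def adjointCoeffT (i : Fin m) (G : R) (r : ℕ) : R :=
  timeCoeff h (C.totalDt F) (fun s => if s = 0 then 0 else coeff 0 (C.lin i s G)) r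

/-- The coefficient of `D_x^J` in the operator `∑_s (-D_t)^s ∘ (lin i s G)^*`. -/
def adjointCoeffX (i : Fin m) (G : R) (J : Fin n →₀ ℕ) : R :=
  adjointCoeff C.totalDx J (C.lin i 0 G) + if J = 0 then C.adjointCoeffT F i G 0 else 0

theorem sum_neg_totalDt_pow_formalAdjoint_lin (hh : 0 < h) {N : ℕ} {i : Fin m} {G : R}
    (hG_zero : (C.lin i 0 G).totalDegree ≤ N)
    (hG_pos : ∀ s ∈ Finset.Ioo 0 h, (C.lin i s G).totalDegree = 0) (f : R) :
    ∑ s ∈ Finset.range h, (((-C.totalDt F : Derivation k R R) : Module.End k R) ^ s)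
        (formalAdjoint C.totalDx (C.lin i s G) f) =
      ∑ J ∈ multiIndicesLE n N, C.adjointCoeffX F i G J * derivPow C.totalDx J f +
        ∑ r ∈ Finset.Ioo 0 h,
          C.adjointCoeffT F i G r * ((C.totalDt F : Module.End k R) ^ r) f := by
  have hsplit : ∀ s ∈ Finset.range h,
      (((-C.totalDt F : Derivation k R R) : Module.End k R) ^ s)
        (formalAdjoint C.totalDx (C.lin i s G) f) =
      (if s = 0 then formalAdjoint C.totalDx (C.lin i 0 G) f else 0) +
        (((-C.totalDt F : Derivation k R R) : Module.End k R) ^ s)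
          ((if s = 0 then 0 else coeff 0 (C.lin i s G)) * f) := by
    intro s hsh
    obtain rfl | hs := s.eq_zero_or_pos
    · simp
    · rw [if_neg hs.ne', if_neg hs.ne', zero_add,
        totalDegree_eq_zero_iff_eq_C.1
          (hG_pos s (Finset.mem_Ioo.2 ⟨hs, Finset.mem_range.1 hsh⟩)),
        formalAdjoint_C, coeff_C, if_pos rfl]
  have hrange : Finset.range h = insert 0 (Finset.Ioo 0 h) := by
    ext s
    simp only [Finset.mem_range, Finset.mem_insert, Finset.mem_Ioo]
    omega
  rw [Finset.sum_congr rfl hsplit, Finset.sum_add_distrib, Finset.sum_ite_eq',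
    if_pos (Finset.mem_range.2 hh), formalAdjoint_eq_sum C.commute_totalDx hG_zero,
    sum_neg_derivation_pow_mul, hrange, Finset.sum_insert (by simp), ← add_assoc]
  congr 1
  simp only [adjointCoeffX, add_mul, Finset.sum_add_distrib, ite_mul, zero_mul]
  rw [Finset.sum_ite_eq', if_pos (by simp)]
  simp [adjointCoeffT]

theorem adjointCoeffX_of_degree_eq {N : ℕ} (hN : 0 < N) {i : Fin m} {G : R}
    (hG : (C.lin i 0 G).totalDegree ≤ N) {J : Fin n →₀ ℕ} (hJ : J.degree = N) :
    C.adjointCoeffX F i G J = (-1) ^ N * coeff J (C.lin i 0 G) := by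
  have hJ_ne : J ≠ 0 := by
    rintro rfl
    simp [hN.ne] at hJ
  rw [adjointCoeffX, if_neg hJ_ne, add_zero, adjointCoeff_eq_sum hG, Finset.sum_eq_single 0]
  · simp [multiBinom, hJ]
  · intro K _ hK
    have hK_pos : 0 < K.degree := Nat.pos_of_ne_zero (mt (Finsupp.degree_eq_zero_iff K).1 hK)
    have hdeg : N < (J + K).degree := by rw [map_add]; omega
    simp [coeff_eq_zero_of_totalDegree_lt (hG.trans_lt hdeg)]
  · simp

end CoordAlgebra

end NormalForm

section LeadingTerms

open MvPolynomial

variable {k R : Type*} [CommRing k] [CommRing R] [Algebra k R]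

theorem totalDegree_coeffwise_le {σ : Type*} (T : Module.End k R) (p : MvPolynomial σ R) :
    (coeffwise T p).totalDegree ≤ p.totalDegree := by
  refine Finset.sup_mono fun I hI => ?_
  rw [mem_support_iff] at hI ⊢
  contrapose! hI
  rw [coeff_coeffwise, hI, map_zero]

theorem homogeneousComponent_coeffwise {σ : Type*} (T : Module.End k R) (d : ℕ)
    (p : MvPolynomial σ R) :
    homogeneousComponent d (coeffwise T p) = coeffwise T (homogeneousComponent d p) := by
  ext I
  simp only [coeff_homogeneousComponent, coeff_coeffwise, apply_ite T, map_zero]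

theorem homogeneousComponent_monomial_mul {σ : Type*} (d : ℕ) (I : σ →₀ ℕ) (b : R)
    (p : MvPolynomial σ R) :
    homogeneousComponent (d + I.degree) (monomial I b * p) =
      monomial I b * homogeneousComponent d p := by
  induction p using MvPolynomial.induction_on' with
  | monomial J a =>
    rw [monomial_mul, homogeneousComponent_of_mem (isHomogeneous_monomial _ rfl),
      homogeneousComponent_of_mem (isHomogeneous_monomial _ rfl), mul_ite, monomial_mul, mul_zero,
      map_add, add_comm I.degree]
    simp only [Nat.add_right_cancel_iff]
  | add p q hp hq => rw [mul_add, map_add, map_add, hp, hq, mul_add]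

theorem totalDegree_monomial_mul_le {σ : Type*} (I : σ →₀ ℕ) (b : R) (p : MvPolynomial σ R) :
    (monomial I b * p).totalDegree ≤ p.totalDegree + I.degree := by
  refine (totalDegree_mul _ _).trans ?_
  rw [add_comm]
  exact add_le_add le_rfl (totalDegree_monomial_le I b)

namespace CoordAlgebra

variable (C : CoordAlgebra k (Coord n m h) R) (F : Fin m → R)

/-- The part `∑_{|I| = d} (∂f/∂u^i_{s,I}) q^I` of the linearization of `f`. -/
def symbolPart (d : ℕ) (i : Fin m) (s : ℕ) : Derivation k R (MvPolynomial (Fin n) R) :=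
  (homogeneousComponent d).compDer (C.lin i s)

theorem symbolPart_apply (d : ℕ) (i : Fin m) (s : ℕ) (f : R) :
    C.symbolPart d i s f = homogeneousComponent d (C.lin i s f) := rfl

theorem totalDegree_lin_derivPow_le (i : Fin m) (s : ℕ) (J : Fin n →₀ ℕ) (f : R) :
    (C.lin i s (derivPow C.totalDx J f)).totalDegree ≤ (C.lin i s f).totalDegree + J.degree := by
  induction J using finsupp_nat_induction with
  | zero => simp
  | add_single J j ih =>
    rw [derivPow_add_single C.commute_totalDx, Module.End.mul_apply, Derivation.coeFn_coe,
      lin_totalDx, map_add, Finsupp.degree_single]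
    refine (totalDegree_add _ _).trans (max_le ?_ ?_)
    · exact (totalDegree_coeffwise_le _ _).trans (ih.trans (by omega))
    · refine (totalDegree_monomial_mul_le _ _ _).trans ?_
      rw [Finsupp.degree_single]
      omega

theorem symbolPart_derivPow {d : ℕ} {i : Fin m} {s : ℕ} {f : R}
    (hf : (C.lin i s f).totalDegree ≤ d) (J : Fin n →₀ ℕ) :
    C.symbolPart (d + J.degree) i s (derivPow C.totalDx J f) =
      monomial J 1 * C.symbolPart d i s f := by
  induction J using finsupp_nat_induction with
  | zero => simp
  | add_single J j ih =>
    have hdeg : (C.lin i s (derivPow C.totalDx J f)).totalDegree <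
        d + (J.degree + (Finsupp.single j 1).degree) := by
      have hle := C.totalDegree_lin_derivPow_le i s J f
      rw [Finsupp.degree_single]
      omega
    rw [derivPow_add_single C.commute_totalDx, Module.End.mul_apply, Derivation.coeFn_coe,
      symbolPart_apply, lin_totalDx, map_add, map_add, homogeneousComponent_coeffwise,
      homogeneousComponent_eq_zero _ _ hdeg, map_zero, zero_add, ← add_assoc, X,
      homogeneousComponent_monomial_mul, ← symbolPart_apply, ih, ← mul_assoc, monomial_mul,
      one_mul, add_comm J]

theorem linComp_eq_sum (i : Fin m) (s : ℕ) (G : R) (p : MvPolynomial (Fin n) R) :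
    C.linComp i s G p = ∑ I ∈ p.support, coeff I p • C.lin i s (derivPow C.totalDx I G) := by
  conv_lhs => rw [p.as_sum]
  simp only [map_sum, linComp_monomial]

theorem exists_mem_support_of_homogeneousComponent_linComp_ne_zero {a d : ℕ} {i : Fin m} {s : ℕ}
    {G : R} (hG : (C.lin i s G).totalDegree ≤ a) {p : MvPolynomial (Fin n) R}
    (hp : homogeneousComponent d (C.linComp i s G p) ≠ 0) :
    ∃ I ∈ p.support, d ≤ I.degree + a := by
  rw [linComp_eq_sum, map_sum] at hp
  obtain ⟨I, hI, hne⟩ := Finset.exists_ne_zero_of_sum_ne_zero hp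
  refine ⟨I, hI, ?_⟩
  contrapose! hne
  have hdeg := C.totalDegree_lin_derivPow_le i s I G
  rw [map_smul, homogeneousComponent_eq_zero _ _ (by omega), smul_zero]

theorem homogeneousComponent_linComp {a d : ℕ} {i : Fin m} {s : ℕ} {G : R}
    (hG : (C.lin i s G).totalDegree ≤ a) {p : MvPolynomial (Fin n) R} (hp : p.totalDegree ≤ d) :
    homogeneousComponent (d + a) (C.linComp i s G p) =
      homogeneousComponent d p * C.symbolPart a i s G := by
  rw [linComp_eq_sum, map_sum]
  conv_rhs => rw [p.as_sum, map_sum, Finset.sum_mul]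
  refine Finset.sum_congr rfl fun I hI => ?_
  have hle : I.degree ≤ d := (le_totalDegree hI).trans hp
  rw [map_smul, homogeneousComponent_of_mem (isHomogeneous_monomial _ rfl)]
  obtain rfl | hlt := hle.eq_or_lt
  · rw [if_pos rfl, add_comm, ← symbolPart_apply, symbolPart_derivPow C hG, ← smul_mul_assoc,
      smul_monomial, smul_eq_mul, mul_one]
  · have hdeg := C.totalDegree_lin_derivPow_le i s I G
    rw [if_neg hlt.ne', zero_mul, homogeneousComponent_eq_zero _ _ (by omega), smul_zero]

end CoordAlgebra

end LeadingTerms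

section TimeDerivatives

open MvPolynomial

variable {k R : Type*} [CommRing k] [CommRing R] [Algebra k R]

/-- The exponents `(s, |I|)` of the variables `u^i_{s,I}` that can occur in `D_t^e f`, `e ≤ h`, when
`f` has order `a` and `t`-order `r` and the system has order `N`: every `D_t` raises `s` by one, and
from `s = h - 1` it leads to `s = 0` with `|I|` raised by at most `N`. -/
def timeRegion (h N a r e : ℕ) : Set (ℕ × ℕ) :=
  {p | p.2 ≤ a + N ∧ (a < p.2 → p.1 < e) ∧ (p.2 = a → p.1 ≤ r + e) ∧
    (p.2 = a + N → p.1 + h ≤ e + r)}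

namespace CoordAlgebra

variable (C : CoordAlgebra k (Coord n m h) R)

/-- Every variable `u^i_{s,I}` on which `f` depends satisfies `(s, |I|) ∈ S`. -/
def DependsOnlyOn (S : Set (ℕ × ℕ)) (f : R) : Prop :=
  ∀ d i s, s < h → C.symbolPart d i s f ≠ 0 → (s, d) ∈ S

/-- The right-hand sides of a system of order at most `N`, in which the derivatives `u^i_{s,I}`
occur only with `s = 0` or `I = 0`. -/
structure IsAdmissible (N : ℕ) (F : Fin m → R) : Prop where
  totalDegree_lin_zero_le : ∀ i l, (C.lin i 0 (F l)).totalDegree ≤ N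
  totalDegree_lin_of_pos : ∀ i l, ∀ s ∈ Finset.Ioo 0 h, (C.lin i s (F l)).totalDegree = 0

variable {C} {F : Fin m → R} {N : ℕ} {f : R} {S : Set (ℕ × ℕ)}

theorem IsAdmissible.totalDegree_lin_le (hF : C.IsAdmissible N F) (i l : Fin m) {s : ℕ}
    (hs : s < h) : (C.lin i s (F l)).totalDegree ≤ if s = 0 then N else 0 := by
  split_ifs with hs₀
  · exact hs₀ ▸ hF.totalDegree_lin_zero_le i l
  · exact (hF.totalDegree_lin_of_pos i l s
      (Finset.mem_Ioo.2 ⟨Nat.pos_of_ne_zero hs₀, hs⟩)).le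

theorem DependsOnlyOn.mono {S' : Set (ℕ × ℕ)} (hf : C.DependsOnlyOn S f) (hS : S ⊆ S') :
    C.DependsOnlyOn S' f :=
  fun d i s hs hne => hS (hf d i s hs hne)

theorem DependsOnlyOn.symbolPart_eq_zero (hf : C.DependsOnlyOn S f) {d s : ℕ} (hs : s < h)
    (hS : (s, d) ∉ S) (i : Fin m) : C.symbolPart d i s f = 0 :=
  by_contra fun hne => hS (hf d i s hs hne)

theorem DependsOnlyOn.mem_of_mem_support (hf : C.DependsOnlyOn S f) {i : Fin m} {s : ℕ} (hs : s < h)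
    {I : Fin n →₀ ℕ} (hI : I ∈ (C.lin i s f).support) : (s, I.degree) ∈ S := by
  refine hf _ i s hs fun hzero => mem_support_iff.1 hI ?_
  simpa [symbolPart_apply, coeff_homogeneousComponent] using congrArg (coeff I) hzero

theorem DependsOnlyOn.totalDegree_lin_le (hf : C.DependsOnlyOn S f) {s a : ℕ} (hs : s < h)
    (hS : ∀ d, (s, d) ∈ S → d ≤ a) (i : Fin m) : (C.lin i s f).totalDegree ≤ a :=
  Finset.sup_le fun _ hI => hS _ (hf.mem_of_mem_support hs hI)

theorem symbolPart_totalDt (F : Fin m → R) (d : ℕ) (i : Fin m) {s : ℕ} (hs : s < h) (f : R) :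
    C.symbolPart d i s (C.totalDt F f) =
      coeffwise (C.totalDt F : Module.End k R) (C.symbolPart d i s f) +
        ((if s = 0 then 0 else C.symbolPart d i (s - 1) f) +
          ∑ l, homogeneousComponent d (C.linComp i s (F l) (C.lin l (h - 1) f))) := by
  simp only [symbolPart_apply, lin_totalDt _ _ _ hs, map_add, map_sum,
    homogeneousComponent_coeffwise, apply_ite (homogeneousComponent d), map_zero]

theorem IsAdmissible.homogeneousComponent_linComp_eq_zero (hF : C.IsAdmissible N F)
    (hf : C.DependsOnlyOn S f) {d s : ℕ} (hs : s < h)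
    (hS : ∀ d', d ≤ d' + (if s = 0 then N else 0) → (h - 1, d') ∉ S) (i l : Fin m) :
    homogeneousComponent d (C.linComp i s (F l) (C.lin l (h - 1) f)) = 0 := by
  by_contra hne
  obtain ⟨I, hI, hd⟩ := C.exists_mem_support_of_homogeneousComponent_linComp_ne_zero
    (hF.totalDegree_lin_le i l hs) hne
  exact hS _ hd (hf.mem_of_mem_support (by omega) hI)

theorem DependsOnlyOn.totalDt (hF : C.IsAdmissible N F) {S' : Set (ℕ × ℕ)}
    (hf : C.DependsOnlyOn S f) (hsub : S ⊆ S')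
    (hshift : ∀ s d, s + 1 < h → (s, d) ∈ S → (s + 1, d) ∈ S')
    (hwrap : ∀ s d d', s < h → d ≤ d' + (if s = 0 then N else 0) → (h - 1, d') ∈ S → (s, d) ∈ S') :
    C.DependsOnlyOn S' (C.totalDt F f) := by
  intro d i s hs hne
  contrapose! hne
  have hprev : (if s = 0 then 0 else C.symbolPart d i (s - 1) f) = 0 := by
    rcases s with _ | s
    · rfl
    · exact hf.symbolPart_eq_zero (by omega) (fun hmem => hne (hshift s d hs hmem)) i
  rw [symbolPart_totalDt F d i hs, hf.symbolPart_eq_zero hs (fun hmem => hne (hsub hmem)), hprev,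
    Finset.sum_eq_zero fun l _ => hF.homogeneousComponent_linComp_eq_zero hf hs
      (fun d' hd hmem => hne (hwrap s d d' hs hd hmem)) i l]
  simp

theorem IsAdmissible.symbolPart_totalDt_succ (hF : C.IsAdmissible N F) (hf : C.DependsOnlyOn S f)
    {d s : ℕ} (hs : s + 1 < h) (hS : (s + 1, d) ∉ S) (hlast : ∀ d', d ≤ d' → (h - 1, d') ∉ S)
    (i : Fin m) : C.symbolPart d i (s + 1) (C.totalDt F f) = C.symbolPart d i s f := by
  rw [symbolPart_totalDt F d i hs, hf.symbolPart_eq_zero hs hS,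
    Finset.sum_eq_zero fun l _ => hF.homogeneousComponent_linComp_eq_zero hf hs hlast i l]
  simp

theorem IsAdmissible.symbolPart_totalDt_zero (hF : C.IsAdmissible N F) (hf : C.DependsOnlyOn S f)
    (hh : 0 < h) {a : ℕ} (hS : (0, a + N) ∉ S) (hlast : ∀ d, (h - 1, d) ∈ S → d ≤ a) (i : Fin m) :
    C.symbolPart (a + N) i 0 (C.totalDt F f) =
      ∑ l, C.symbolPart a l (h - 1) f * C.symbolPart N i 0 (F l) := by
  rw [symbolPart_totalDt F _ i hh, hf.symbolPart_eq_zero hh hS, map_zero, if_pos rfl, zero_add,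
    zero_add]
  exact Finset.sum_congr rfl fun l _ => C.homogeneousComponent_linComp
    (hF.totalDegree_lin_zero_le i l) (hf.totalDegree_lin_le (by omega) hlast l)

variable {a r : ℕ}

theorem IsAdmissible.dependsOnlyOn_totalDt_pow (hF : C.IsAdmissible N F) (hN : 0 < N)
    (hf : C.DependsOnlyOn {p | p.2 ≤ a ∧ (p.2 = a → p.1 ≤ r)} f) {e : ℕ} (he : e ≤ h) :
    C.DependsOnlyOn (timeRegion h N a r e) (((C.totalDt F : Module.End k R) ^ e) f) := by
  induction e with
  | zero =>
    refine hf.mono fun p hp => ?_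
    simp only [timeRegion, Set.mem_ofPred_eq] at hp ⊢
    omega
  | succ e ih =>
    rw [pow_succ', Module.End.mul_apply]
    refine (ih (by omega)).totalDt hF (fun p hp => ?_) (fun s d _ hp => ?_)
      fun s d d' hs hd hp => ?_
    all_goals
      simp only [timeRegion, Set.mem_ofPred_eq] at hp ⊢
      grind

theorem IsAdmissible.symbolPart_totalDt_pow_of_add_lt (hF : C.IsAdmissible N F) (hN : 0 < N)
    (hf : C.DependsOnlyOn {p | p.2 ≤ a ∧ (p.2 = a → p.1 ≤ r)} f) (i : Fin m) {e : ℕ}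
    (he : r + e < h) :
    C.symbolPart a i (r + e) (((C.totalDt F : Module.End k R) ^ e) f) = C.symbolPart a i r f := by
  induction e with
  | zero => rfl
  | succ e ih =>
    rw [pow_succ', Module.End.mul_apply, ← ih (by omega)]
    refine hF.symbolPart_totalDt_succ (hF.dependsOnlyOn_totalDt_pow hN hf (by omega)) he ?_
      (fun d' hd => ?_) i
    all_goals
      simp only [timeRegion, Set.mem_ofPred_eq]
      grind

theorem IsAdmissible.symbolPart_totalDt_pow_sub_add (hF : C.IsAdmissible N F) (hN : 0 < N)
    (hf : C.DependsOnlyOn {p | p.2 ≤ a ∧ (p.2 = a → p.1 ≤ r)} f) (hr : r < h) (i : Fin m) {s : ℕ}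
    (hs : s ≤ r) :
    C.symbolPart (a + N) i s (((C.totalDt F : Module.End k R) ^ (h - r + s)) f) =
      ∑ l, C.symbolPart a l r f * C.symbolPart N i 0 (F l) := by
  induction s with
  | zero =>
    obtain ⟨e, rfl⟩ := Nat.exists_eq_add_of_lt hr
    rw [show r + e + 1 - r + 0 = e + 1 by omega, pow_succ', Module.End.mul_apply,
      Derivation.coeFn_coe]
    have hdep := hF.dependsOnlyOn_totalDt_pow hN hf (e := e) (by omega)
    rw [hF.symbolPart_totalDt_zero hdep (by omega)]
    · simp only [Nat.add_sub_cancel,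
        hF.symbolPart_totalDt_pow_of_add_lt hN hf _ (Nat.lt_succ_self _)]
    · simp only [timeRegion, Set.mem_ofPred_eq]
      grind
    · intro d hd
      simp only [timeRegion, Set.mem_ofPred_eq] at hd
      omega
  | succ s ih =>
    rw [← add_assoc, pow_succ', Module.End.mul_apply, ← ih (by omega)]
    refine hF.symbolPart_totalDt_succ (hF.dependsOnlyOn_totalDt_pow hN hf (by omega)) (by omega) ?_
      (fun d' hd => ?_) i
    all_goals
      simp only [timeRegion, Set.mem_ofPred_eq]
      grind

/- Under the `h` applications of `D_t` the exponents `(s, |I|)` of the leading variable run through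
`(r, a) → ⋯ → (h - 1, a) → (0, a + N) → ⋯ → (r, a + N)`. -/
theorem IsAdmissible.symbolPart_totalDt_pow_self (hF : C.IsAdmissible N F) (hN : 0 < N)
    (hf : C.DependsOnlyOn {p | p.2 ≤ a ∧ (p.2 = a → p.1 ≤ r)} f) (hr : r < h) (i : Fin m) :
    C.symbolPart (a + N) i r (((C.totalDt F : Module.End k R) ^ h) f) =
      ∑ l, C.symbolPart a l r f * C.symbolPart N i 0 (F l) := by
  rw [← hF.symbolPart_totalDt_pow_sub_add hN hf hr i le_rfl, Nat.sub_add_cancel hr.le]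

theorem IsAdmissible.symbolPart_totalDt_pow_eq_zero (hF : C.IsAdmissible N F) (hN : 0 < N)
    (hf : C.DependsOnlyOn {p | p.2 ≤ a ∧ (p.2 = a → p.1 ≤ r)} f) (hr : r < h) (i : Fin m) {e : ℕ}
    (he : e < h) : C.symbolPart (a + N) i r (((C.totalDt F : Module.End k R) ^ e) f) = 0 := by
  refine (hF.dependsOnlyOn_totalDt_pow hN hf he.le).symbolPart_eq_zero hr ?_ i
  simp only [timeRegion, Set.mem_ofPred_eq]
  grind

end CoordAlgebra

end TimeDerivatives

section SymbolEquation

open MvPolynomial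

variable {k R : Type*} [CommRing k] [CommRing R] [Algebra k R]

theorem homogeneousComponent_eq_sum_multiIndicesLE (N : ℕ) (p : MvPolynomial (Fin n) R) :
    homogeneousComponent N p =
      ∑ J ∈ multiIndicesLE n N, if J.degree = N then monomial J (coeff J p) else 0 := by
  classical
  ext I
  simp only [coeff_homogeneousComponent, coeff_sum, apply_ite (coeff I), coeff_monomial, coeff_zero]
  rw [Finset.sum_eq_single I (fun J _ hJ => by simp [hJ])
    fun hI => if_neg fun hdeg => hI (mem_multiIndicesLE.2 hdeg.le), if_pos rfl]

namespace CoordAlgebra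

variable {C : CoordAlgebra k (Coord n m h) R} {F : Fin m → R} {N a r : ℕ}

theorem symbolPart_mul_derivPow {i : Fin m} {b f : R} {J : Fin n →₀ ℕ} (hJ : J.degree ≤ N)
    (hf : (C.lin i r f).totalDegree ≤ a) (hb : C.symbolPart (a + N) i r b = 0) :
    C.symbolPart (a + N) i r (b * derivPow C.totalDx J f) =
      if J.degree = N then monomial J b * C.symbolPart a i r f else 0 := by
  rw [Derivation.leibniz, hb, smul_zero, add_zero]
  split_ifs with hdeg
  · rw [← hdeg, symbolPart_derivPow C hf, ← smul_mul_assoc, smul_monomial, smul_eq_mul, mul_one]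
  · have hle := C.totalDegree_lin_derivPow_le i r J f
    rw [symbolPart_apply, homogeneousComponent_eq_zero _ _ (by omega), smul_zero]

theorem IsAdmissible.symbolPart_normalForm (hF : C.IsAdmissible N F) (hN : 0 < N) (hr : r < h)
    {f : R} (hf : C.DependsOnlyOn {p | p.2 ≤ a ∧ (p.2 = a → p.1 ≤ r)} f) {i j l : Fin m}
    (hX : ∀ J, J.degree ≤ N → C.symbolPart (a + N) j r (C.adjointCoeffX F i (F l) J) = 0)
    (hT : ∀ e ∈ Finset.Ioo 0 h, C.symbolPart (a + N) j r (C.adjointCoeffT F i (F l) e) = 0) :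
    C.symbolPart (a + N) j r
        (∑ J ∈ multiIndicesLE n N, C.adjointCoeffX F i (F l) J * derivPow C.totalDx J f +
          ∑ e ∈ Finset.Ioo 0 h,
            C.adjointCoeffT F i (F l) e * ((C.totalDt F : Module.End k R) ^ e) f) =
      (-1) ^ N * (C.symbolPart N i 0 (F l) * C.symbolPart a j r f) := by
  have hdeg : (C.lin j r f).totalDegree ≤ a := hf.totalDegree_lin_le hr (fun _ hd => hd.1) j
  have htime : ∀ e ∈ Finset.Ioo 0 h, C.symbolPart (a + N) j r
      (C.adjointCoeffT F i (F l) e * ((C.totalDt F : Module.End k R) ^ e) f) = 0 := by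
    intro e he
    rw [Derivation.leibniz, hT e he,
      hF.symbolPart_totalDt_pow_eq_zero hN hf hr j (Finset.mem_Ioo.1 he).2, smul_zero, smul_zero,
      add_zero]
  have hspace : ∀ J ∈ multiIndicesLE n N, C.symbolPart (a + N) j r
      (C.adjointCoeffX F i (F l) J * derivPow C.totalDx J f) =
      (-1) ^ N * ((if J.degree = N then monomial J (coeff J (C.lin i 0 (F l))) else 0) *
        C.symbolPart a j r f) := by
    intro J hJ
    have hJ_le := mem_multiIndicesLE.1 hJ
    rw [symbolPart_mul_derivPow hJ_le hdeg (hX J hJ_le)]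
    split_ifs with hJ_eq
    · rw [C.adjointCoeffX_of_degree_eq F hN (hF.totalDegree_lin_zero_le i l) hJ_eq, ← mul_assoc,
        ← smul_eq_mul (a := (-1 : R) ^ N), ← smul_monomial, smul_eq_C_mul, C_pow, C_neg, C_1]
    · simp
  rw [map_add, map_sum, map_sum, Finset.sum_eq_zero htime, add_zero, Finset.sum_congr rfl hspace,
    ← Finset.mul_sum, ← Finset.sum_mul, ← homogeneousComponent_eq_sum_multiIndicesLE,
    symbolPart_apply C N]

theorem IsAdmissible.symbolPart_intertwine (hF : C.IsAdmissible N F) (hN : 0 < N) (hr : r < h)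
    {χ : Fin m → R}
    (hχ : ∀ i, C.DependsOnlyOn {p | p.2 ≤ a ∧ (p.2 = a → p.1 ≤ r)} (χ i))
    (hadj : ∀ i, (((-C.totalDt F : Derivation k R R) : Module.End k R) ^ h) (χ i) =
      ∑ s ∈ Finset.range h, (((-C.totalDt F : Derivation k R R) : Module.End k R) ^ s)
        (∑ l, formalAdjoint C.totalDx (C.lin i s (F l)) (χ l)))
    (hX : ∀ i j l J, J.degree ≤ N →
      C.symbolPart (a + N) j r (C.adjointCoeffX F i (F l) J) = 0)
    (hT : ∀ i j l, ∀ e ∈ Finset.Ioo 0 h,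
      C.symbolPart (a + N) j r (C.adjointCoeffT F i (F l) e) = 0) (i j : Fin m) :
    (-1) ^ h * ∑ l, C.symbolPart a l r (χ i) * C.symbolPart N j 0 (F l) =
      (-1) ^ N * ∑ l, C.symbolPart N i 0 (F l) * C.symbolPart a j r (χ l) := by
  have hnormal := hadj i
  simp only [map_sum] at hnormal
  rw [Finset.sum_comm, Finset.sum_congr rfl fun l _ =>
    C.sum_neg_totalDt_pow_formalAdjoint_lin F (by omega) (hF.totalDegree_lin_zero_le i l)
      (hF.totalDegree_lin_of_pos i l) (χ l), neg_derivation_pow_apply] at hnormal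
  have hsymbol := congrArg (C.symbolPart (a + N) j r) hnormal
  rw [map_sum, Finset.sum_congr rfl fun l _ =>
    hF.symbolPart_normalForm hN hr (hχ l) (hX i j l) (hT i j l), ← Finset.mul_sum,
    Derivation.leibniz, hF.symbolPart_totalDt_pow_self hN (hχ i) hr] at hsymbol
  simpa [smul_eq_C_mul, Derivation.leibniz_pow] using hsymbol

end CoordAlgebra

end SymbolEquation

section RestrictUpdate

variable {ι : Type*}

theorem isOpen_restrict_image {U : Set (ι → ℝ)} (hU : IsOpen U) (s : Finset ι) :
    IsOpen (s.restrict '' U) := by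
  classical
  have hrestrict : (s.restrict : (ι → ℝ) → (s → ℝ)) =
      Prod.fst ∘ Homeomorph.piEquivPiSubtypeProd (fun c => c ∈ s) (fun _ : ι => ℝ) := rfl
  rw [hrestrict, Set.image_comp]
  exact isOpenMap_fst _ ((Homeomorph.isOpenMap _) _ hU)

variable [DecidableEq ι]

theorem eventually_update_mem {U : Set (ι → ℝ)} (hU : IsOpen U) {θ : ι → ℝ} (hθ : θ ∈ U) (c : ι) :
    ∀ᶠ r in nhds (θ c), Function.update θ c r ∈ U := by
  have hcont : Continuous fun r : ℝ => Function.update θ c r :=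
    continuous_const.update c continuous_id
  refine hcont.continuousAt.eventually_mem ?_
  rw [Function.update_eq_self]
  exact hU.mem_nhds hθ

theorem restrict_update_of_mem (s : Finset ι) {c : ι} (hc : c ∈ s) (θ : ι → ℝ) (r : ℝ) :
    s.restrict (Function.update θ c r) = Function.update (s.restrict θ) ⟨c, hc⟩ r := by
  ext d
  by_cases hd : d = ⟨c, hc⟩
  · subst hd; simp
  · have hdc : (d : ι) ≠ c := fun h => hd (Subtype.ext h)
    simp [hd, hdc]

theorem restrict_update_of_notMem (s : Finset ι) {c : ι} (hc : c ∉ s) (θ : ι → ℝ) (r : ℝ) :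
    s.restrict (Function.update θ c r) = s.restrict θ := by
  ext d
  have hdc : (d : ι) ≠ c := fun h => hc (h ▸ d.2)
  simp [hdc]

/-- The direction of the coordinate `c` in the space of the coordinates from `s`; it is zero if `c`
is not among them. -/
def coordVec (s : Finset ι) (c : ι) : s → ℝ :=
  if hc : c ∈ s then Pi.single ⟨c, hc⟩ 1 else 0

theorem hasDerivAt_restrict_update (s : Finset ι) (θ : ι → ℝ) (c : ι) :
    HasDerivAt (fun r : ℝ => s.restrict (Function.update θ c r)) (coordVec s c) (θ c) := by
  unfold coordVec
  split_ifs with hc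
  · simp_rw [restrict_update_of_mem s hc]
    exact hasDerivAt_update (s.restrict θ) ⟨c, hc⟩ (θ c)
  · simp_rw [restrict_update_of_notMem s hc]
    exact hasDerivAt_const _ _

end RestrictUpdate

section PartialDerivatives

variable {U : Set (Jet n m h)} {V : Set (Coord n m h)} {r r' : WithTop ℕ∞} {f g : JetFun n m h}

theorem pd_congr (hU : IsOpen U) (hfg : ∀ θ ∈ U, f θ = g θ) (c : Coord n m h) {θ : Jet n m h}
    (hθ : θ ∈ U) : pd c f θ = pd c g θ :=
  Filter.EventuallyEq.deriv_eq ((eventually_update_mem hU hθ c).mono fun _ hr => hfg _ hr)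

section Representation

variable {s : Finset (Coord n m h)} {φ : (s → ℝ) → ℝ}

theorem hasDerivAt_update_of_eq_restrict (hU : IsOpen U) (hr : r ≠ 0)
    (hφ : ContDiffOn ℝ r φ (s.restrict '' U)) (hf : ∀ θ ∈ U, f θ = φ (s.restrict θ))
    (c : Coord n m h) {θ : Jet n m h} (hθ : θ ∈ U) :
    HasDerivAt (fun r : ℝ => f (Function.update θ c r))
      (fderiv ℝ φ (s.restrict θ) (coordVec s c)) (θ c) := by
  have hφ' : HasFDerivAt φ (fderiv ℝ φ (s.restrict θ))
      (s.restrict (Function.update θ c (θ c))) := by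
    rw [Function.update_eq_self]
    exact ((hφ.differentiableOn hr).differentiableAt
      ((isOpen_restrict_image hU s).mem_nhds ⟨θ, hθ, rfl⟩)).hasFDerivAt
  exact (hφ'.comp_hasDerivAt (θ c) (hasDerivAt_restrict_update s θ c)).congr_of_eventuallyEq
    ((eventually_update_mem hU hθ c).mono fun _ hr => hf _ hr)

theorem pd_eq_of_eq_restrict (hU : IsOpen U) (hr : r ≠ 0)
    (hφ : ContDiffOn ℝ r φ (s.restrict '' U)) (hf : ∀ θ ∈ U, f θ = φ (s.restrict θ))
    (c : Coord n m h) {θ : Jet n m h} (hθ : θ ∈ U) :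
    pd c f θ = fderiv ℝ φ (s.restrict θ) (coordVec s c) :=
  (hasDerivAt_update_of_eq_restrict hU hr hφ hf c hθ).deriv

theorem contDiffOn_fderiv_apply (hU : IsOpen U) (hr : r' + 1 ≤ r)
    (hφ : ContDiffOn ℝ r φ (s.restrict '' U)) (v : s → ℝ) :
    ContDiffOn ℝ r' (fun y => fderiv ℝ φ y v) (s.restrict '' U) :=
  (hφ.fderiv_of_isOpen (isOpen_restrict_image hU s) hr).clm_apply contDiffOn_const

theorem exists_eq_restrict_of_subset {s' : Finset (Coord n m h)} (hs : s ⊆ s')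
    (hφ : ContDiffOn ℝ r φ (s.restrict '' U)) (hf : ∀ θ ∈ U, f θ = φ (s.restrict θ)) :
    ∃ φ' : (s' → ℝ) → ℝ, ContDiffOn ℝ r φ' (s'.restrict '' U) ∧
      ∀ θ ∈ U, f θ = φ' (s'.restrict θ) := by
  refine ⟨fun y => φ (fun i => y ⟨i, hs i.2⟩), ?_, fun θ hθ => hf θ hθ⟩
  refine hφ.comp (t := s.restrict '' U) (f := fun (y : s' → ℝ) (i : s) => y ⟨i, hs i.2⟩)
    (contDiff_pi.2 fun i => contDiff_apply ℝ ℝ _).contDiffOn ?_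
  rintro _ ⟨θ, hθ, rfl⟩
  exact ⟨θ, hθ, rfl⟩

end Representation

theorem ne_zero_of_add_one_le (hr : r' + 1 ≤ r) : r ≠ 0 := by
  rintro rfl
  exact absurd (le_add_self.trans hr : (1 : WithTop ℕ∞) ≤ 0) (by simp)

namespace IsFunOf

theorem hasDerivAt (hf : IsFunOf U V r f) (hU : IsOpen U) (hr : r ≠ 0) (c : Coord n m h)
    {θ : Jet n m h} (hθ : θ ∈ U) :
    HasDerivAt (fun r : ℝ => f (Function.update θ c r)) (pd c f θ) (θ c) := by
  obtain ⟨s, -, φ, hφ, hfφ⟩ := hf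
  exact (hasDerivAt_update_of_eq_restrict hU hr hφ hfφ c hθ).differentiableAt.hasDerivAt

protected theorem pd (hf : IsFunOf U V r f) (hU : IsOpen U) (hr : r' + 1 ≤ r) (c : Coord n m h) :
    IsFunOf U V r' (pd c f) := by
  obtain ⟨s, hs, φ, hφ, hfφ⟩ := hf
  exact ⟨s, hs, fun y => fderiv ℝ φ y (coordVec s c), contDiffOn_fderiv_apply hU hr hφ _,
    fun θ hθ => pd_eq_of_eq_restrict hU (ne_zero_of_add_one_le hr) hφ hfφ c hθ⟩

theorem congr (hf : IsFunOf U V r f) (hfg : ∀ θ ∈ U, g θ = f θ) : IsFunOf U V r g := by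
  obtain ⟨s, hs, φ, hφ, hfφ⟩ := hf
  exact ⟨s, hs, φ, hφ, fun θ hθ => (hfg θ hθ).trans (hfφ θ hθ)⟩

theorem mono {V' : Set (Coord n m h)} (hf : IsFunOf U V r f) (hV : V ⊆ V') : IsFunOf U V' r f := by
  obtain ⟨s, hs, φ, hφ, hfφ⟩ := hf
  exact ⟨s, hs.trans hV, φ, hφ, hfφ⟩

theorem map₂ (hf : IsFunOf U V r f) (hg : IsFunOf U V r g) {ψ : ℝ × ℝ → ℝ}
    (hψ : ContDiff ℝ r ψ) : IsFunOf U V r (fun θ => ψ (f θ, g θ)) := by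
  obtain ⟨s, hs, α, hα, hfα⟩ := hf
  obtain ⟨t, ht, β, hβ, hgβ⟩ := hg
  obtain ⟨α', hα', hfα'⟩ :=
    exists_eq_restrict_of_subset (s' := s ∪ t) Finset.subset_union_left hα hfα
  obtain ⟨β', hβ', hgβ'⟩ :=
    exists_eq_restrict_of_subset (s' := s ∪ t) Finset.subset_union_right hβ hgβ
  exact ⟨s ∪ t, by simp [hs, ht], fun y => ψ (α' y, β' y), hψ.comp_contDiffOn (hα'.prodMk hβ'),
    fun θ hθ => by simp only [hfα' θ hθ, hgβ' θ hθ]⟩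

theorem add (hf : IsFunOf U V r f) (hg : IsFunOf U V r g) :
    IsFunOf U V r (fun θ => f θ + g θ) :=
  hf.map₂ hg (ψ := fun p => p.1 + p.2) (contDiff_fst.add contDiff_snd)

theorem mul (hf : IsFunOf U V r f) (hg : IsFunOf U V r g) :
    IsFunOf U V r (fun θ => f θ * g θ) :=
  hf.map₂ hg (ψ := fun p => p.1 * p.2) (contDiff_fst.mul contDiff_snd)

theorem const (U : Set (Jet n m h)) (V : Set (Coord n m h)) (r : WithTop ℕ∞) (a : ℝ) :
    IsFunOf U V r (fun _ => a) :=
  ⟨∅, by simp, fun _ => a, contDiffOn_const, fun _ _ => rfl⟩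

theorem coord (U : Set (Jet n m h)) (r : WithTop ℕ∞) (c : Coord n m h) :
    IsFunOf U {c} r (fun θ => θ c) :=
  ⟨{c}, by simp, fun y => y ⟨c, by simp⟩, (contDiff_apply ℝ ℝ _).contDiffOn, fun _ _ => rfl⟩

theorem exists_finset_pd_eq_zero (hf : IsFunOf U V r f) (hU : IsOpen U) (hr : r ≠ 0) :
    ∃ s : Finset (Coord n m h), (s : Set (Coord n m h)) ⊆ V ∧
      ∀ c ∉ s, ∀ θ ∈ U, GenEvol.pd c f θ = 0 := by
  obtain ⟨s, hs, φ, hφ, hfφ⟩ := hf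
  refine ⟨s, hs, fun c hc θ hθ => ?_⟩
  rw [pd_eq_of_eq_restrict hU hr hφ hfφ c hθ]
  simp [coordVec, hc]

end IsFunOf

namespace IsSmooth

theorem hasDerivAt (hf : IsSmooth U f) (hU : IsOpen U) (c : Coord n m h) {θ : Jet n m h}
    (hθ : θ ∈ U) : HasDerivAt (fun r : ℝ => f (Function.update θ c r)) (pd c f θ) (θ c) :=
  IsFunOf.hasDerivAt hf hU (by simp) c hθ

protected theorem pd (hf : IsSmooth U f) (hU : IsOpen U) (c : Coord n m h) : IsSmooth U (pd c f) :=
  IsFunOf.pd hf hU le_rfl c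

theorem pd_add (hf : IsSmooth U f) (hg : IsSmooth U g) (hU : IsOpen U) (c : Coord n m h)
    {θ : Jet n m h} (hθ : θ ∈ U) :
    GenEvol.pd c (fun θ => f θ + g θ) θ = GenEvol.pd c f θ + GenEvol.pd c g θ :=
  ((hf.hasDerivAt hU c hθ).add (hg.hasDerivAt hU c hθ)).deriv

theorem pd_const_mul (hf : IsSmooth U f) (hU : IsOpen U) (c : Coord n m h) (a : ℝ)
    {θ : Jet n m h} (hθ : θ ∈ U) :
    GenEvol.pd c (fun θ => a * f θ) θ = a * GenEvol.pd c f θ :=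
  ((hf.hasDerivAt hU c hθ).const_mul a).deriv

theorem pd_mul (hf : IsSmooth U f) (hg : IsSmooth U g) (hU : IsOpen U) (c : Coord n m h)
    {θ : Jet n m h} (hθ : θ ∈ U) :
    GenEvol.pd c (fun θ => f θ * g θ) θ = f θ * GenEvol.pd c g θ + g θ * GenEvol.pd c f θ := by
  have hderiv := ((hf.hasDerivAt hU c hθ).mul (hg.hasDerivAt hU c hθ)).deriv
  simp only [Function.update_eq_self] at hderiv
  rw [add_comm, mul_comm (g θ)]
  exact hderiv

theorem exists_pd_pd_eq (hf : IsSmooth U f) (hU : IsOpen U) : ∃ s : Finset (Coord n m h),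
    ∃ φ : (s → ℝ) → ℝ, ContDiffOn ℝ ∞ φ (s.restrict '' U) ∧ ∀ c d, ∀ θ ∈ U,
      GenEvol.pd c (GenEvol.pd d f) θ =
        fderiv ℝ (fderiv ℝ φ) (s.restrict θ) (coordVec s c) (coordVec s d) := by
  obtain ⟨s, -, φ, hφ, hfφ⟩ := hf
  refine ⟨s, φ, hφ, fun c d θ hθ => ?_⟩
  rw [pd_eq_of_eq_restrict (r := ∞) hU (by simp)
    (contDiffOn_fderiv_apply hU le_rfl hφ (coordVec s d))
    (fun θ hθ => pd_eq_of_eq_restrict hU (by simp) hφ hfφ d hθ) c hθ]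
  have hdiff : DifferentiableAt ℝ (fderiv ℝ φ) (s.restrict θ) :=
    ((hφ.fderiv_of_isOpen (m := ∞) (isOpen_restrict_image hU s) le_rfl).differentiableOn
      (by simp)).differentiableAt ((isOpen_restrict_image hU s).mem_nhds ⟨θ, hθ, rfl⟩)
  rw [fderiv_clm_apply hdiff (differentiableAt_const _)]
  simp

theorem pd_comm (hf : IsSmooth U f) (hU : IsOpen U) (c d : Coord n m h) {θ : Jet n m h}
    (hθ : θ ∈ U) : GenEvol.pd c (GenEvol.pd d f) θ = GenEvol.pd d (GenEvol.pd c f) θ := by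
  obtain ⟨s, φ, hφ, hpd⟩ := hf.exists_pd_pd_eq hU
  rw [hpd c d θ hθ, hpd d c θ hθ]
  refine ((hφ.contDiffAt
    ((isOpen_restrict_image hU s).mem_nhds ⟨θ, hθ, rfl⟩)).isSymmSndFDerivAt ?_) _ _
  rw [minSmoothness_of_isRCLikeNormedField]
  exact WithTop.coe_le_coe.2 (le_top : (2 : ℕ∞) ≤ ⊤)

end IsSmooth

end PartialDerivatives

section SmoothAlgebra

/-- The coordinate algebra whose partial derivatives are the commuting derivations `d c`. -/
def CoordAlgebra.ofDerivations {k ι R : Type*} [CommRing k] [CommRing R] [Algebra k R]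
    (d : ι → Derivation k R R) (finite_d : ∀ f, (Function.support fun c => d c f).Finite)
    (d_comm : ∀ c c' f, d c (d c' f) = d c' (d c f)) (coord : ι → R)
    (d_coord : ∀ c c', d c' (coord c) = Finsupp.single c 1 c') : CoordAlgebra k ι R where
  grad := Derivation.mk'
    { toFun := fun f => Finsupp.ofSupportFinite (fun c => d c f) (finite_d f)
      map_add' := fun f g => Finsupp.ext fun c => map_add (d c) f g
      map_smul' := fun a f => Finsupp.ext fun c => (d c).map_smul a f }
    fun f g => Finsupp.ext fun c => (d c).leibniz f g
  coord := coord
  grad_coord c := Finsupp.ext (d_coord c)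
  grad_grad_comm c c' f := d_comm c' c f

/-- The algebra of smooth functions on `U`, each depending on finitely many coordinates. -/
def smoothAlgebra (U : Set (Jet n m h)) : Subalgebra ℝ (U → ℝ) where
  carrier := {a | ∃ f, IsSmooth U f ∧ ∀ θ : U, a θ = f θ}
  mul_mem' := by
    rintro a b ⟨f, hf, haf⟩ ⟨g, hg, hbg⟩
    exact ⟨_, IsFunOf.mul hf hg, fun θ => by simp [haf, hbg]⟩
  add_mem' := by
    rintro a b ⟨f, hf, haf⟩ ⟨g, hg, hbg⟩
    exact ⟨_, IsFunOf.add hf hg, fun θ => by simp [haf, hbg]⟩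
  algebraMap_mem' r := ⟨_, IsFunOf.const U _ _ r, fun _ => rfl⟩

variable {U : Set (Jet n m h)}

theorem smoothAlgebra_ext {a b : smoothAlgebra U} (hab : ∀ θ : U, a.1 θ = b.1 θ) : a = b :=
  Subtype.ext (funext hab)

/-- `f` takes on `U` the values of the element `a` of the algebra of smooth functions. -/
def Rep (f : JetFun n m h) (a : smoothAlgebra U) : Prop := ∀ θ : U, a.1 θ = f θ

theorem IsSmooth.exists_rep {f : JetFun n m h} (hf : IsSmooth U f) :
    ∃ a : smoothAlgebra U, Rep f a :=
  ⟨⟨fun θ => f θ, f, hf, fun _ => rfl⟩, fun _ => rfl⟩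

/-- The extension by zero of an element of the algebra of smooth functions to all jets. -/
def extendZero (a : smoothAlgebra U) : JetFun n m h := Function.extend Subtype.val a.1 0

theorem rep_extendZero (a : smoothAlgebra U) : Rep (extendZero a) a := fun θ =>
  (Subtype.val_injective.extend_apply a.1 0 θ).symm

theorem rep_zero : Rep (fun _ => 0) (0 : smoothAlgebra U) := fun _ => rfl

theorem rep_natCast (k : ℕ) : Rep (fun _ => (k : ℝ)) (k : smoothAlgebra U) := fun _ => rfl

theorem rep_neg_one_pow (k : ℕ) : Rep (fun _ => (-1) ^ k) ((-1) ^ k : smoothAlgebra U) :=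
  fun _ => rfl

namespace Rep

variable {f g : JetFun n m h} {a b : smoothAlgebra U}

theorem isSmooth (hf : Rep f a) : IsSmooth U f := by
  obtain ⟨g, hg, hag⟩ := a.2
  exact hg.congr fun θ hθ => ((hf ⟨θ, hθ⟩).symm.trans (hag ⟨θ, hθ⟩))

theorem congr (hf : Rep f a) (hfg : ∀ θ ∈ U, g θ = f θ) : Rep g a :=
  fun θ => (hf θ).trans (hfg θ θ.2).symm

theorem eqOn (hf : Rep f a) (hg : Rep g a) : ∀ θ ∈ U, f θ = g θ :=
  fun θ hθ => (hf ⟨θ, hθ⟩).symm.trans (hg ⟨θ, hθ⟩)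

theorem add (hf : Rep f a) (hg : Rep g b) : Rep (fun θ => f θ + g θ) (a + b) :=
  fun θ => congrArg₂ (· + ·) (hf θ) (hg θ)

theorem mul (hf : Rep f a) (hg : Rep g b) : Rep (fun θ => f θ * g θ) (a * b) :=
  fun θ => congrArg₂ (· * ·) (hf θ) (hg θ)

theorem const_mul (hf : Rep f a) (r : ℝ) : Rep (fun θ => r * f θ) (r • a) :=
  fun θ => congrArg (r * ·) (hf θ)

theorem ite {p : Prop} [Decidable p] (hf : p → Rep f a) (hg : ¬p → Rep g b) :
    Rep (fun θ => if p then f θ else g θ) (if p then a else b) := by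
  split_ifs with hp
  · exact hf hp
  · exact hg hp

section Sum

variable {ι : Type*} {φ : ι → JetFun n m h} {α : ι → smoothAlgebra U}

theorem sum {s : Finset ι} (hφ : ∀ i ∈ s, Rep (φ i) (α i)) :
    Rep (fun θ => ∑ i ∈ s, φ i θ) (∑ i ∈ s, α i) := by
  intro θ
  rw [AddSubmonoidClass.coe_finsetSum, Finset.sum_apply]
  exact Finset.sum_congr rfl fun i hi => hφ i hi θ

theorem finsum {s : Finset ι} (hφ : ∀ i, Rep (φ i) (α i)) (hα : ∀ i ∉ s, α i = 0) :
    Rep (fun θ => ∑ᶠ i, φ i θ) (∑ i ∈ s, α i) := by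
  refine (sum fun i _ => hφ i).congr fun θ hθ => finsum_eq_sum_of_support_subset _ ?_
  refine Function.support_subset_iff'.2 fun i hi => ?_
  rw [← hφ i ⟨θ, hθ⟩, hα i hi]
  rfl

end Sum

end Rep

/-- The partial derivative with respect to `c` on the algebra of smooth functions. -/
def smoothPd (hU : IsOpen U) (c : Coord n m h) : Derivation ℝ (smoothAlgebra U) (smoothAlgebra U) :=
  Derivation.mk'
    { toFun := fun a => ⟨fun θ => pd c (extendZero a) θ, pd c (extendZero a),
        (rep_extendZero a).isSmooth.pd hU c, fun _ => rfl⟩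
      map_add' := fun a b => smoothAlgebra_ext fun θ =>
        (pd_congr hU
          ((rep_extendZero (a + b)).eqOn ((rep_extendZero a).add (rep_extendZero b))) c θ.2).trans
          ((rep_extendZero a).isSmooth.pd_add (rep_extendZero b).isSmooth hU c θ.2)
      map_smul' := fun r a => smoothAlgebra_ext fun θ =>
        (pd_congr hU ((rep_extendZero (r • a)).eqOn ((rep_extendZero a).const_mul r)) c θ.2).trans
          ((rep_extendZero a).isSmooth.pd_const_mul hU c r θ.2) }
    fun a b => smoothAlgebra_ext fun θ => by
      refine ((pd_congr hU ((rep_extendZero (a * b)).eqOn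
        ((rep_extendZero a).mul (rep_extendZero b))) c θ.2).trans
          ((rep_extendZero a).isSmooth.pd_mul (rep_extendZero b).isSmooth hU c θ.2)).trans ?_
      rw [← rep_extendZero a θ, ← rep_extendZero b θ]
      rfl

theorem Rep.smoothPd {f : JetFun n m h} {a : smoothAlgebra U} (hf : Rep f a) (hU : IsOpen U)
    (c : Coord n m h) : Rep (pd c f) (smoothPd hU c a) :=
  fun θ => pd_congr hU ((rep_extendZero a).eqOn hf) c θ.2

theorem finite_support_smoothPd (hU : IsOpen U) (a : smoothAlgebra U) :
    (Function.support fun c => smoothPd hU c a).Finite := by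
  obtain ⟨s, -, hs⟩ :=
    IsFunOf.exists_finset_pd_eq_zero (rep_extendZero a).isSmooth hU (by simp)
  refine s.finite_toSet.subset (Function.support_subset_iff'.2 fun c hc => ?_)
  exact smoothAlgebra_ext fun θ => ((rep_extendZero a).smoothPd hU c θ).trans (hs c hc θ θ.2)

theorem smoothPd_comm (hU : IsOpen U) (c c' : Coord n m h) (a : smoothAlgebra U) :
    smoothPd hU c (smoothPd hU c' a) = smoothPd hU c' (smoothPd hU c a) :=
  smoothAlgebra_ext fun θ => by
    have ha := rep_extendZero a
    rw [(ha.smoothPd hU c').smoothPd hU c θ, (ha.smoothPd hU c).smoothPd hU c' θ]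
    exact ha.isSmooth.pd_comm hU c c' θ.2

theorem pd_coord (c c' : Coord n m h) (θ : Jet n m h) :
    pd c' (fun θ => θ c) θ = if c = c' then 1 else 0 := by
  unfold pd
  split_ifs with hc
  · subst hc
    simp
  · simp [Function.update_of_ne hc]

/-- The coordinate `c` as an element of the algebra of smooth functions. -/
def smoothCoord (U : Set (Jet n m h)) (c : Coord n m h) : smoothAlgebra U :=
  ⟨fun θ => θ.1 c, fun θ => θ c, (IsFunOf.coord U _ c).mono (Set.subset_univ _), fun _ => rfl⟩

theorem rep_smoothCoord (c : Coord n m h) : Rep (fun θ => θ c) (smoothCoord U c) := fun _ => rfl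

/-- The smooth functions on `U` as an algebra of functions of the jet coordinates. -/
def smoothCoordAlgebra (hU : IsOpen U) : CoordAlgebra ℝ (Coord n m h) (smoothAlgebra U) :=
  .ofDerivations (smoothPd hU) (finite_support_smoothPd hU) (smoothPd_comm hU) (smoothCoord U)
    fun c c' => smoothAlgebra_ext fun θ => by
      rw [(rep_smoothCoord c).smoothPd hU c' θ, pd_coord, Finsupp.single_apply]
      split_ifs <;> rfl

end SmoothAlgebra

section Transfer

variable {U : Set (Jet n m h)} {f : JetFun n m h} {a : smoothAlgebra U}

theorem finsum_coord_eq_add_finsum {M : Type*} [AddCommMonoid M] {φ : Coord n m h → M}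
    (hφ : (Function.support φ).Finite) {c₀ : Coord n m h} (hc₀ : ∀ i s I, c₀ ≠ .u i s I)
    (hzero : ∀ c, c ≠ c₀ → (∀ i s I, c ≠ .u i s I) → φ c = 0) :
    ∑ᶠ c, φ c = φ c₀ + ∑ᶠ p : Fin m × Fin h × (Fin n →₀ ℕ), φ (.u p.1 p.2.1 p.2.2) := by
  set jetCoord : Fin m × Fin h × (Fin n →₀ ℕ) → Coord n m h := fun p => .u p.1 p.2.1 p.2.2
  have hinj : Function.Injective jetCoord := by
    rintro ⟨i, s, I⟩ ⟨i', s', I'⟩ hp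
    simpa [jetCoord] using hp
  have hc₀_range : c₀ ∉ Set.range jetCoord := by
    rintro ⟨p, hp⟩
    exact hc₀ _ _ _ hp.symm
  have hsupp : Function.support φ ⊆ insert c₀ (Set.range jetCoord) := by
    refine Function.support_subset_iff'.2 fun c hc => hzero c (fun h => hc (.inl h)) ?_
    rintro i s I rfl
    exact hc (.inr ⟨(i, s, I), rfl⟩)
  rw [← finsum_mem_range hinj, ← finsum_mem_insert' _ hc₀_range (hφ.subset Set.inter_subset_right),
    ← finsum_mem_univ]
  refine finsum_mem_inter_support_eq _ _ _ ?_
  rw [Set.univ_inter, Set.inter_eq_right.2 hsupp]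

namespace Rep

theorem grad (hf : Rep f a) (hU : IsOpen U) (c : Coord n m h) :
    Rep (pd c f) ((smoothCoordAlgebra hU).grad a c) :=
  hf.smoothPd hU c

theorem vectorField (hf : Rep f a) (hU : IsOpen U) {b : Coord n m h → JetFun n m h}
    {β : Coord n m h → smoothAlgebra U} (hb : ∀ c, Rep (b c) (β c)) {c₀ : Coord n m h}
    (hc₀ : ∀ i s I, c₀ ≠ .u i s I) (hβ : β c₀ = 1)
    (hzero : ∀ c, c ≠ c₀ → (∀ i s I, c ≠ .u i s I) → β c = 0) :
    Rep (fun θ => pd c₀ f θ + ∑ᶠ p : Fin m × Fin h × (Fin n →₀ ℕ),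
      b (.u p.1 p.2.1 p.2.2) θ * pd (.u p.1 p.2.1 p.2.2) f θ)
      ((smoothCoordAlgebra hU).vectorField β a) := by
  have hsum : Rep (fun θ => ∑ᶠ c, b c θ * pd c f θ) ((smoothCoordAlgebra hU).vectorField β a) := by
    rw [CoordAlgebra.vectorField_apply, Finsupp.linearCombination_apply]
    simp only [Finsupp.sum, smul_eq_mul, mul_comm _ (β _)]
    exact finsum (fun c => (hb c).mul (hf.grad hU c)) fun c hc => by
      rw [Finsupp.notMem_support_iff.1 hc, mul_zero]
  refine hsum.congr fun θ hθ => ?_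
  have hb_eq (c r) (hc : β c = r) : b c θ = r.1 ⟨θ, hθ⟩ := hc ▸ (hb c ⟨θ, hθ⟩).symm
  have hfin : (Function.support fun c => b c θ * pd c f θ).Finite := by
    refine ((smoothCoordAlgebra hU).grad a).support.finite_toSet.subset
      (Function.support_subset_iff'.2 fun c hc => ?_)
    rw [← hf.grad hU c ⟨θ, hθ⟩, Finsupp.notMem_support_iff.1 hc]
    exact mul_zero _
  rw [finsum_coord_eq_add_finsum hfin hc₀, hb_eq c₀ 1 hβ]
  · exact congrArg (· + _) (one_mul _).symm
  · intro c hc hcu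
    rw [hb_eq c 0 (hzero c hc hcu)]
    exact zero_mul _

theorem totalDx (hf : Rep f a) (hU : IsOpen U) (j : Fin n) :
    Rep (Dx j f) ((smoothCoordAlgebra hU).totalDx j a) := by
  refine hf.vectorField hU (c₀ := .x j) (b := fun
    | .t => fun _ => 0
    | .x i => fun _ => if i = j then 1 else 0
    | .u i s I => fun θ => θ (.u i s (I + Finsupp.single j 1))) ?_ (by simp) (by simp) ?_
  · rintro (_ | i | ⟨i, s, I⟩)
    · exact rep_zero
    · exact .ite (fun _ _ => rfl) (fun _ _ => rfl)
    · exact rep_smoothCoord _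
  · rintro (_ | i | ⟨i, s, I⟩) hc hcu
    · rfl
    · exact if_neg (by simpa using hc)
    · exact absurd rfl (hcu i s I)

theorem iterate {D : JetFun n m h → JetFun n m h} {T : Module.End ℝ (smoothAlgebra U)}
    (hD : ∀ {f a}, Rep f a → Rep (D f) (T a)) (hf : Rep f a) (k : ℕ) :
    Rep (D^[k] f) ((T ^ k) a) := by
  induction k with
  | zero => exact hf
  | succ k ih =>
    rw [Function.iterate_succ_apply', pow_succ', Module.End.mul_apply]
    exact hD ih

theorem derivPow (hf : Rep f a) (hU : IsOpen U) (I : Fin n →₀ ℕ) :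
    Rep (DxI I f) (derivPow (smoothCoordAlgebra hU).totalDx I a) := by
  unfold GenEvol.derivPow multiPow DxI
  induction List.finRange n with
  | nil => exact hf
  | cons j l ih => exact iterate (fun hf => hf.totalDx hU j) ih (I j)

theorem coeff_lin (hf : Rep f a) (hU : IsOpen U) (i : Fin m) (s : Fin h) (I : Fin n →₀ ℕ) :
    Rep (pd (.u i s I) f) (MvPolynomial.coeff I ((smoothCoordAlgebra hU).lin i s a)) := by
  rw [CoordAlgebra.coeff_lin]
  exact hf.grad hU _

theorem timeCoeff {D : JetFun n m h → JetFun n m h}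
    {T : Derivation ℝ (smoothAlgebra U) (smoothAlgebra U)}
    (hD : ∀ {f a}, Rep f a → Rep (D f) (T a)) {b : Fin h → JetFun n m h}
    {β : ℕ → smoothAlgebra U} (hb : ∀ s : Fin h, Rep (b s) (β s)) (r : ℕ) :
    Rep (fun θ => ∑ s : Fin h, if r ≤ s then
      (-1) ^ (s : ℕ) * ((s : ℕ).choose r : ℝ) * D^[s - r] (b s) θ else 0) (timeCoeff h T β r) := by
  rw [GenEvol.timeCoeff, Finset.sum_range]
  exact sum fun s _ => .ite (fun _ => ((rep_neg_one_pow _).mul (rep_natCast _)).mul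
    (iterate hD (hb s) _)) fun _ => rep_zero

end Rep

namespace GenEvolSystem

variable (E : GenEvolSystem n m h)

/-- The smooth functions on the domain of the system, with their partial derivatives. -/
abbrev coordAlgebra : CoordAlgebra ℝ (Coord n m h) (smoothAlgebra E.U) :=
  smoothCoordAlgebra E.isOpen_U

theorem isSmooth_F (i : Fin m) : IsSmooth E.U (E.F i) := (E.smooth_F i).mono (Set.subset_univ _)

variable {E} {F : Fin m → smoothAlgebra E.U}

theorem rep_totalDt (hF : ∀ i, Rep (E.F i) (F i)) {f : JetFun n m h} {a : smoothAlgebra E.U}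
    (hf : Rep f a) : Rep (E.Dt f) (E.coordAlgebra.totalDt F a) := by
  refine hf.vectorField E.isOpen_U (c₀ := .t) (b := fun
    | .t => fun _ => 1
    | .x _ => fun _ => 0
    | .u i s I => E.dtCoord i s I) ?_ (by simp) rfl ?_
  · rintro (_ | _ | ⟨i, s, I⟩)
    · exact fun _ => rfl
    · exact rep_zero
    · unfold dtCoord
      dsimp only
      split_ifs
      · exact rep_smoothCoord _
      · exact (hF i).derivPow E.isOpen_U I
  · rintro (_ | i | ⟨i, s, I⟩) hc hcu
    · exact absurd rfl hc
    · rfl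
    · exact absurd rfl (hcu i s I)

theorem rep_adjointCoeffT (hF : ∀ i, Rep (E.F i) (F i)) (i j : Fin m) (r : ℕ) :
    Rep (fun θ => ∑ s : Fin h, if r ≤ s ∧ 0 < (s : ℕ) then
        (-1) ^ (s : ℕ) * ((s : ℕ).choose r : ℝ) * E.Dt^[s - r] (pd (.u i s 0) (E.F j)) θ else 0)
      (E.coordAlgebra.adjointCoeffT F i (F j) r) := by
  refine (Rep.timeCoeff (rep_totalDt hF) (b := fun s =>
    if (s : ℕ) = 0 then fun _ => 0 else pd (.u i s 0) (E.F j)) (fun s => ?_) r).congr fun _ _ => ?_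
  · split_ifs
    · exact rep_zero
    · exact (hF j).coeff_lin E.isOpen_U i s 0
  · refine Finset.sum_congr rfl fun s _ => ?_
    rcases Nat.eq_zero_or_pos (s : ℕ) with hs | hs
    · simp [hs]
    · simp [hs, hs.ne']

theorem rep_coeffT (hF : ∀ i, Rep (E.F i) (F i)) (i j : Fin m) {r : ℕ} (hr : 0 < r) :
    Rep (E.coeffT i j r) (E.coordAlgebra.adjointCoeffT F i (F j) r) :=
  (rep_adjointCoeffT hF i j r).congr fun θ _ => Finset.sum_congr rfl fun s _ => by
    simp only [and_iff_left_of_imp hr.trans_le]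

theorem rep_coeffX (hF : ∀ i, Rep (E.F i) (F i)) (i j : Fin m) (J : Fin n →₀ ℕ) :
    Rep (E.coeffX i j J) (E.coordAlgebra.adjointCoeffX F i (F j) J) := by
  have hzero : Rep (fun θ => ∑ s : Fin h, if 0 < (s : ℕ) then
      (-1) ^ (s : ℕ) * (E.Dt)^[(s : ℕ)] (pd (.u i s 0) (E.F j)) θ else 0)
      (E.coordAlgebra.adjointCoeffT F i (F j) 0) := by
    simpa using rep_adjointCoeffT hF i j 0
  refine Rep.add ?_ (.ite (fun _ => hzero) fun _ => rep_zero)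
  rw [adjointCoeff_eq_sum le_rfl]
  refine (Rep.finsum (fun K => (rep_neg_one_pow _).mul ((rep_natCast _).mul
    (((hF j).coeff_lin E.isOpen_U i ⟨0, E.h_pos⟩ (J + K)).derivPow E.isOpen_U K))) ?_).congr
    fun _ _ => ?_
  · intro K hK
    rw [coeff_add_eq_zero_of_notMem_multiIndicesLE le_rfl hK, map_zero, mul_zero, mul_zero]
  · simp only [mul_assoc, multiBinom, Nat.cast_prod]

theorem rep_currentCharacteristic {J : Fin (n + 1) → JetFun n m h} {ρ : smoothAlgebra E.U}
    (hρ : Rep (J 0) ρ) (i : Fin m) :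
    Rep (E.currentCharacteristic J i) (E.coordAlgebra.euler i (h - 1) ρ) := by
  rw [CoordAlgebra.euler, formalAdjoint_apply E.coordAlgebra.commute_totalDx le_rfl]
  refine Rep.finsum (fun I => (rep_neg_one_pow _).mul ?_) fun I hI => ?_
  · rw [mul_one]
    exact (hρ.coeff_lin E.isOpen_U i ⟨h - 1, Nat.sub_lt E.h_pos Nat.one_pos⟩ I).derivPow
      E.isOpen_U I
  · simp [coeff_eq_zero_of_notMem_multiIndicesLE le_rfl hI]

theorem IsConservedCurrent.exists_totalDt_eq (hF : ∀ i, Rep (E.F i) (F i))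
    {J : Fin (n + 1) → JetFun n m h} (hJ : E.IsConservedCurrent J)
    {ρ : smoothAlgebra E.U} (hρ : Rep (J 0) ρ) :
    ∃ g : Fin n → smoothAlgebra E.U,
      E.coordAlgebra.totalDt F ρ = ∑ j, E.coordAlgebra.totalDx j (g j) := by
  choose a ha using fun k => (hJ.1 k).exists_rep
  refine ⟨fun j => -a j.succ, ?_⟩
  simp only [map_neg, Finset.sum_neg_distrib]
  refine eq_neg_of_add_eq_zero_left (smoothAlgebra_ext fun θ => ?_)
  refine ((rep_totalDt hF hρ).add
    (Rep.sum fun j _ => (ha (Fin.succ j)).totalDx E.isOpen_U j) θ).trans ?_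
  have hsum := hJ.2 θ θ.2
  rwa [Fin.sum_univ_succ] at hsum

end GenEvolSystem

end Transfer

section Order

variable {U : Set (Jet n m h)} {k : ℕ} {f : Fin k → JetFun n m h}

theorem bddAbove_orderSet (hU : IsOpen U) (hf : ∀ i, IsSmooth U (f i)) :
    BddAbove (insert (-1) {d : ℤ | ∃ (i : Fin k) (j : Fin m) (s : Fin h) (I : Fin n →₀ ℕ),
      (∃ θ ∈ U, pd (.u j s I) (f i) θ ≠ 0) ∧ d = (I.degree : ℤ)}) := by
  choose S _ hS using fun i => IsFunOf.exists_finset_pd_eq_zero (hf i) hU (by simp)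
  let deg : Coord n m h → ℤ := fun
    | .u _ _ I => I.degree
    | _ => 0
  refine BddAbove.insert _ (Set.Finite.bddAbove
    ((Set.finite_iUnion fun i => (S i).finite_toSet.image deg).subset ?_))
  rintro d ⟨i, j, s, I, ⟨θ, hθ, hpd⟩, rfl⟩
  exact Set.mem_iUnion.2 ⟨i, .u j s I, by_contra fun hc => hpd (hS i _ hc θ hθ), rfl⟩

theorem degree_le_order (hU : IsOpen U) (hf : ∀ i, IsSmooth U (f i)) {i : Fin k} {j : Fin m}
    {s : Fin h} {I : Fin n →₀ ℕ} {θ : Jet n m h} (hθ : θ ∈ U) (hpd : pd (.u j s I) (f i) θ ≠ 0) :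
    (I.degree : ℤ) ≤ order U f :=
  le_csSup (bddAbove_orderSet hU hf) (Set.mem_insert_of_mem _ ⟨i, j, s, I, ⟨θ, hθ, hpd⟩, rfl⟩)

theorem exists_degree_eq_order (hU : IsOpen U) (hf : ∀ i, IsSmooth U (f i))
    (hord : order U f ≠ -1) : ∃ (i : Fin k) (j : Fin m) (s : Fin h) (I : Fin n →₀ ℕ),
      (∃ θ ∈ U, pd (.u j s I) (f i) θ ≠ 0) ∧ (I.degree : ℤ) = order U f := by
  rcases Int.csSup_mem (Set.insert_nonempty _ _) (bddAbove_orderSet hU hf) with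
    hsup | ⟨i, j, s, I, hpd, hd⟩
  · exact absurd hsup hord
  · exact ⟨i, j, s, I, hpd, hd.symm⟩

theorem bddAbove_tOrderSet : BddAbove {b : ℕ | ∃ (i : Fin k) (j : Fin m) (s : Fin h)
    (I : Fin n →₀ ℕ), (∃ θ ∈ U, pd (.u j s I) (f i) θ ≠ 0) ∧
      (I.degree : ℤ) = order U f ∧ b = (s : ℕ)} := by
  refine ⟨h, ?_⟩
  rintro b ⟨i, j, s, I, -, -, rfl⟩
  exact s.2.le

theorem le_tOrder {i : Fin k} {j : Fin m} {s : Fin h} {I : Fin n →₀ ℕ} {θ : Jet n m h}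
    (hθ : θ ∈ U) (hpd : pd (.u j s I) (f i) θ ≠ 0) (hI : (I.degree : ℤ) = order U f) :
    (s : ℕ) ≤ tOrder U f :=
  le_csSup bddAbove_tOrderSet ⟨i, j, s, I, ⟨θ, hθ, hpd⟩, hI, rfl⟩

theorem exists_eq_tOrder (hU : IsOpen U) (hf : ∀ i, IsSmooth U (f i))
    (hord : order U f ≠ -1) : ∃ (i : Fin k) (j : Fin m) (s : Fin h) (I : Fin n →₀ ℕ),
      (∃ θ ∈ U, pd (.u j s I) (f i) θ ≠ 0) ∧ (I.degree : ℤ) = order U f ∧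
        tOrder U f = (s : ℕ) := by
  refine Nat.sSup_mem ?_ bddAbove_tOrderSet
  obtain ⟨i, j, s, I, hpd, hd⟩ := exists_degree_eq_order hU hf hord
  exact ⟨s, i, j, s, I, hpd, hd, rfl⟩

theorem coeff_symbolMatrix (a b : ℕ) (f : Fin k → JetFun n m h) (θ : Jet n m h) (i : Fin k)
    (j : Fin m) (I : Fin n →₀ ℕ) :
    MvPolynomial.coeff I (symbolMatrix a b f θ i j) =
      if I.degree = a then if hb : b < h then pd (.u j ⟨b, hb⟩ I) (f i) θ else 0 else 0 := by
  simp only [symbolMatrix, Matrix.of_apply, MvPolynomial.coeff_sum, MvPolynomial.coeff_monomial]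
  rw [Finset.sum_ite_eq']
  simp [Finset.mem_finsuppAntidiag, Finsupp.degree_eq_sum]

theorem exists_pd_ne_zero_of_symbol_ne_zero {θ : Jet n m h} (hne : symbol U f θ ≠ 0) :
    ∃ (i : Fin k) (j : Fin m) (s : Fin h) (I : Fin n →₀ ℕ), pd (.u j s I) (f i) θ ≠ 0 ∧
      I.degree = (order U f).toNat ∧ (s : ℕ) = tOrder U f := by
  by_contra! hzero
  refine hne ?_
  ext i j I
  rw [symbol, coeff_symbolMatrix]
  split_ifs with hd hb
  · exact by_contra fun hpd => hzero i j ⟨_, hb⟩ I hpd hd rfl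
  all_goals rfl

theorem symbol_ne_zero_of_pd_ne_zero {θ : Jet n m h} {i : Fin k} {j : Fin m} {s : Fin h}
    {I : Fin n →₀ ℕ} (hpd : pd (.u j s I) (f i) θ ≠ 0) (hI : I.degree = (order U f).toNat)
    (hs : (s : ℕ) = tOrder U f) : symbol U f θ ≠ 0 := by
  intro hzero
  have hcoeff := congrArg (MvPolynomial.coeff I) (congrFun₂ hzero i j)
  rw [symbol, coeff_symbolMatrix, if_pos hI, dif_pos (hs ▸ s.2)] at hcoeff
  exact hpd (by simpa [← hs] using hcoeff)

theorem exists_symbol_ne_zero (hU : IsOpen U) (hf : ∀ i, IsSmooth U (f i))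
    (hord : order U f ≠ -1) : ∃ θ ∈ U, symbol U f θ ≠ 0 := by
  obtain ⟨i, j, s, I, ⟨θ, hθ, hpd⟩, hd, hs⟩ := exists_eq_tOrder hU hf hord
  exact ⟨θ, hθ, symbol_ne_zero_of_pd_ne_zero hpd (by omega) hs.symm⟩

end Order

section SymbolTransfer

open MvPolynomial

variable {U : Set (Jet n m h)} {k : ℕ}

/-- Evaluation of smooth functions at the point `θ` of `U`. -/
def evalAt (θ : U) : smoothAlgebra U →+* ℝ :=
  (Pi.evalRingHom (fun _ : U => ℝ) θ).comp (smoothAlgebra U).toSubring.subtype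

theorem Rep.evalAt {f : JetFun n m h} {a : smoothAlgebra U} (hf : Rep f a) (θ : U) :
    evalAt θ a = f θ := hf θ

theorem map_evalAt_symbolPart {f : Fin k → JetFun n m h} {a : Fin k → smoothAlgebra U}
    (hf : ∀ i, Rep (f i) (a i)) (hU : IsOpen U) (d : ℕ) {s : ℕ} (hs : s < h) (θ : U) (i : Fin k)
    (j : Fin m) :
    map (evalAt θ) ((smoothCoordAlgebra hU).symbolPart d j s (a i)) =
      symbolMatrix d s f θ i j := by
  ext I
  rw [coeff_map, CoordAlgebra.symbolPart_apply, coeff_homogeneousComponent, coeff_symbolMatrix,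
    dif_pos hs, apply_ite (evalAt θ), map_zero, ((hf i).coeff_lin hU j ⟨s, hs⟩ I).evalAt]

theorem Rep.exists_pd_ne_zero {f : JetFun n m h} {a : smoothAlgebra U} (hf : Rep f a)
    (hU : IsOpen U) {i : Fin m} {s : Fin h} {I : Fin n →₀ ℕ}
    (hI : I ∈ ((smoothCoordAlgebra hU).lin i s a).support) :
    ∃ θ ∈ U, pd (.u i s I) f θ ≠ 0 := by
  by_contra! hzero
  exact mem_support_iff.1 hI
    (smoothAlgebra_ext fun θ => (hf.coeff_lin hU i s I θ).trans (hzero θ θ.2))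

theorem Rep.exists_pd_ne_zero_of_symbolPart_ne_zero {f : JetFun n m h} {a : smoothAlgebra U}
    (hf : Rep f a) (hU : IsOpen U) {d : ℕ} {i : Fin m} {s : Fin h}
    (hne : (smoothCoordAlgebra hU).symbolPart d i s a ≠ 0) :
    ∃ I : Fin n →₀ ℕ, I.degree = d ∧ ∃ θ ∈ U, pd (.u i s I) f θ ≠ 0 := by
  obtain ⟨I, hI⟩ := ne_zero_iff.1 hne
  rw [CoordAlgebra.symbolPart_apply, coeff_homogeneousComponent] at hI
  exact ⟨I, (ite_ne_right_iff.1 hI).1, hf.exists_pd_ne_zero hU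
    (mem_support_iff.2 (ite_ne_right_iff.1 hI).2)⟩

theorem dependsOnlyOn_of_rep {f : Fin k → JetFun n m h} {a : Fin k → smoothAlgebra U}
    (hf : ∀ i, Rep (f i) (a i)) (hU : IsOpen U) (i : Fin k) :
    (smoothCoordAlgebra hU).DependsOnlyOn
      {p | p.2 ≤ (order U f).toNat ∧ (p.2 = (order U f).toNat → p.1 ≤ tOrder U f)} (a i) := by
  intro d j s hs hne
  obtain ⟨I, rfl, θ, hθ, hpd⟩ :=
    (hf i).exists_pd_ne_zero_of_symbolPart_ne_zero hU (s := ⟨s, hs⟩) hne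
  have hle := degree_le_order hU (fun i => (hf i).isSmooth) hθ hpd
  exact ⟨by omega, fun hd => le_tOrder hθ hpd (by omega)⟩

namespace GenEvolSystem

variable {E : GenEvolSystem n m h}

theorem order_F (hN : 0 < E.N) : order E.U E.F = E.N := by
  unfold N at hN ⊢
  omega

theorem pd_F_eq_zero (E : GenEvolSystem n m h) (i j : Fin m) {s : Fin h} {I : Fin n →₀ ℕ}
    (hs : (s : ℕ) ≠ 0) (hI : I ≠ 0) {θ : Jet n m h} (hθ : θ ∈ E.U) :
    pd (.u j s I) (E.F i) θ = 0 := by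
  obtain ⟨V, hV, hpd⟩ := (E.smooth_F i).exists_finset_pd_eq_zero E.isOpen_U (by simp)
  exact hpd _ (fun hmem => (hV hmem j s I rfl).elim hs hI) θ hθ

theorem tOrder_F (hN : 0 < E.N) : tOrder E.U E.F = 0 := by
  refine Nat.le_zero.1 (csSup_le' ?_)
  rintro b ⟨i, j, s, I, ⟨θ, hθ, hpd⟩, hI, rfl⟩
  by_contra hs
  refine hpd (E.pd_F_eq_zero i j (by omega) ?_ hθ)
  rintro rfl
  rw [order_F hN, map_zero] at hI
  omega

theorem symbol_F (hN : 0 < E.N) (θ : Jet n m h) :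
    symbol E.U E.F θ = symbolMatrix E.N 0 E.F θ := by
  rw [symbol, tOrder_F hN, N]

theorem isAdmissible {F : Fin m → smoothAlgebra E.U} (hF : ∀ i, Rep (E.F i) (F i)) :
    E.coordAlgebra.IsAdmissible E.N F where
  totalDegree_lin_zero_le i l := Finset.sup_le fun I hI => by
    obtain ⟨θ, hθ, hpd⟩ := (hF l).exists_pd_ne_zero E.isOpen_U (s := ⟨0, E.h_pos⟩) hI
    have hle := degree_le_order E.isOpen_U E.isSmooth_F hθ hpd
    change I.degree ≤ E.N
    unfold N
    omega
  totalDegree_lin_of_pos i l s hs := by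
    rw [Finset.mem_Ioo] at hs
    refine Nat.le_zero.1 (Finset.sup_le fun I hI => ?_)
    obtain ⟨θ, hθ, hpd⟩ := (hF l).exists_pd_ne_zero E.isOpen_U (s := ⟨s, hs.2⟩) hI
    have hI₀ : I = 0 := by_contra fun hI₀ => hpd (E.pd_F_eq_zero l i hs.1.ne' hI₀ hθ)
    simp [hI₀]

theorem bddAbove_O (E : GenEvolSystem n m h) : BddAbove (insert (-1)
    ({d : ℤ | ∃ (i j : Fin m) (J : Fin n →₀ ℕ), J.degree ≤ E.N ∧
        d = E.ord (E.coeffX i j J) - E.N} ∪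
     {d : ℤ | ∃ (i j : Fin m) (r : ℕ), 0 < r ∧ r < h ∧
        d = E.ord (E.coeffT i j r) - E.N})) := by
  refine BddAbove.insert _ (BddAbove.union (Set.Finite.bddAbove ?_) (Set.Finite.bddAbove ?_))
  · refine ((Finset.univ ×ˢ Finset.univ ×ˢ multiIndicesLE n E.N).finite_toSet.image
      fun p : Fin m × Fin m × (Fin n →₀ ℕ) => E.ord (E.coeffX p.1 p.2.1 p.2.2) - E.N).subset ?_
    rintro d ⟨i, j, J, hJ, rfl⟩
    exact ⟨(i, j, J), by simpa using hJ, rfl⟩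
  · refine ((Finset.univ ×ˢ Finset.univ ×ˢ Finset.range h).finite_toSet.image
      fun p : Fin m × Fin m × ℕ => E.ord (E.coeffT p.1 p.2.1 p.2.2) - E.N).subset ?_
    rintro d ⟨i, j, r, -, hr, rfl⟩
    exact ⟨(i, j, r), by simpa using hr, rfl⟩

theorem neg_one_le_O (E : GenEvolSystem n m h) : -1 ≤ E.O :=
  le_csSup E.bddAbove_O (Set.mem_insert _ _)

theorem ord_coeffX_le (E : GenEvolSystem n m h) (i j : Fin m) {J : Fin n →₀ ℕ}
    (hJ : J.degree ≤ E.N) : E.ord (E.coeffX i j J) ≤ E.O + E.N :=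
  sub_le_iff_le_add.1 (le_csSup E.bddAbove_O (.inr (.inl ⟨i, j, J, hJ, rfl⟩)))

theorem ord_coeffT_le (E : GenEvolSystem n m h) (i j : Fin m) {r : ℕ} (hr : r ∈ Finset.Ioo 0 h) :
    E.ord (E.coeffT i j r) ≤ E.O + E.N :=
  sub_le_iff_le_add.1 (le_csSup E.bddAbove_O
    (.inr (.inr ⟨i, j, r, (Finset.mem_Ioo.1 hr).1, (Finset.mem_Ioo.1 hr).2, rfl⟩)))

theorem symbolPart_eq_zero_of_ord_lt {f : JetFun n m h} {a : smoothAlgebra E.U} (hf : Rep f a)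
    {d : ℕ} (hd : E.ord f < d) (j : Fin m) {s : ℕ} (hs : s < h) :
    E.coordAlgebra.symbolPart d j s a = 0 := by
  by_contra hne
  obtain ⟨I, rfl, θ, hθ, hpd⟩ :=
    hf.exists_pd_ne_zero_of_symbolPart_ne_zero E.isOpen_U (s := ⟨s, hs⟩) hne
  exact hd.not_ge (degree_le_order (f := fun _ : Fin 1 => f) E.isOpen_U (fun _ => hf.isSmooth)
    (i := 0) hθ hpd)

end GenEvolSystem

theorem transpose_mul_add_mul_eq_zero_of_odd {ι R : Type*} [Fintype ι] [CommRing R]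
    {A S : Matrix ι ι R} {N h : ℕ} (hodd : Odd (N + h))
    (hAS : ∀ i j, (-1) ^ h * ∑ l, S i l * A l j = (-1) ^ N * ∑ l, A l i * S l j) :
    A.transpose * S + S * A = 0 := by
  ext i j
  have hsign : (-1 : R) ^ N * (-1) ^ h = -1 := by rw [← pow_add, hodd.neg_one_pow]
  have hsq : (-1 : R) ^ N * (-1) ^ N = 1 := by rw [← mul_pow]; simp
  simp only [Matrix.add_apply, Matrix.mul_apply, Matrix.transpose_apply, Matrix.zero_apply]
  linear_combination (-(-1) ^ N) * hAS i j - (∑ l, A l i * S l j) * hsq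
    + (∑ l, S i l * A l j) * hsign

namespace GenEvolSystem

variable {E : GenEvolSystem n m h} {J : Fin (n + 1) → JetFun n m h} {χ : Fin m → JetFun n m h}

theorem IsConservedCurrent.isSmooth_characteristic (hJ : E.IsConservedCurrent J)
    (hχ : ∀ i, ∀ θ ∈ E.U, χ i θ = E.currentCharacteristic J i θ) (i : Fin m) :
    IsSmooth E.U (χ i) := by
  obtain ⟨ρ, hρ⟩ := (hJ.1 0).exists_rep
  exact ((rep_currentCharacteristic hρ i).congr (hχ i)).isSmooth

theorem IsConservedCurrent.transpose_symbol_mul_add_mul_symbol_eq_zero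
    (hJ : E.IsConservedCurrent J) (hN : 0 < E.N)
    (hodd : Odd (E.N + h)) (hχ : ∀ i, ∀ θ ∈ E.U, χ i θ = E.currentCharacteristic J i θ)
    (hO : E.O < order E.U χ) {θ : Jet n m h} (hθ : θ ∈ E.U) :
    (symbol E.U E.F θ).transpose * symbol E.U χ θ + symbol E.U χ θ * symbol E.U E.F θ = 0 := by
  choose F hF using fun i => (E.isSmooth_F i).exists_rep
  obtain ⟨ρ, hρ⟩ := (hJ.1 0).exists_rep
  obtain ⟨g, hg⟩ := hJ.exists_totalDt_eq hF hρ
  have hχ_rep (i : Fin m) : Rep (χ i) (E.coordAlgebra.euler i (h - 1) ρ) :=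
    (rep_currentCharacteristic hρ i).congr (hχ i)
  have hord : -1 < order E.U χ := E.neg_one_le_O.trans_lt hO
  have hr : tOrder E.U χ < h := by
    obtain ⟨-, -, s, -, -, -, hs⟩ :=
      exists_eq_tOrder E.isOpen_U (hJ.isSmooth_characteristic hχ) hord.ne'
    exact hs ▸ s.2
  have hsymbol (i j : Fin m) := congrArg (map (evalAt ⟨θ, hθ⟩))
    ((isAdmissible hF).symbolPart_intertwine hN hr (dependsOnlyOn_of_rep hχ_rep E.isOpen_U)
      (E.coordAlgebra.neg_totalDt_pow_euler F E.h_pos hg)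
      (fun i j l J hJ => symbolPart_eq_zero_of_ord_lt (rep_coeffX hF i l J)
        ((E.ord_coeffX_le i l hJ).trans_lt (by push_cast; omega)) j hr)
      (fun i j l e he => symbolPart_eq_zero_of_ord_lt (rep_coeffT hF i l (Finset.mem_Ioo.1 he).1)
        ((E.ord_coeffT_le i l he).trans_lt (by push_cast; omega)) j hr) i j)
  simp only [map_mul, map_sum, map_pow, map_neg, map_one,
    map_evalAt_symbolPart hF E.isOpen_U _ E.h_pos, map_evalAt_symbolPart hχ_rep E.isOpen_U _ hr]
    at hsymbol
  rw [symbol_F hN]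
  exact transpose_mul_add_mul_eq_zero_of_odd hodd hsymbol

end GenEvolSystem

end SymbolTransfer

section LinearAlgebra

open Polynomial

theorem semiconjBy_aeval {R A : Type*} [CommSemiring R] [Semiring A] [Algebra R A] {s x y : A}
    (hs : SemiconjBy s x y) (p : R[X]) : SemiconjBy s (aeval x p) (aeval y p) := by
  induction p using Polynomial.induction_on' with
  | add p q hp hq => simpa only [map_add] using hp.add_right hq
  | monomial k a =>
    simp only [aeval_monomial]
    have hcomm : SemiconjBy s (algebraMap R A a) (algebraMap R A a) := (Algebra.commutes a s).symm
    exact hcomm.mul_right (hs.pow_right k)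

variable {K : Type*} [Field K] (A : Matrix (Fin m) (Fin m) K)

theorem charDet_eq : charDet A = (-1) ^ m * A.charpoly := by
  have hneg : A.map C - Matrix.scalar (Fin m) (X : K[X]) = -A.charmatrix := by
    rw [Matrix.charmatrix, neg_sub]
    rfl
  rw [charDet, hneg, Matrix.det_neg, Fintype.card_fin]
  rfl

theorem charDet_ne_zero : charDet A ≠ 0 := by
  rw [charDet_eq]
  exact mul_ne_zero (pow_ne_zero _ (neg_ne_zero.2 one_ne_zero)) A.charpoly_monic.ne_zero

theorem aeval_self_charDet : aeval A (charDet A) = 0 := by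
  rw [charDet_eq, map_mul, Matrix.aeval_self_charpoly, mul_zero]

theorem charDet_transpose : charDet A.transpose = charDet A := by
  rw [charDet_eq, charDet_eq, Matrix.charpoly_transpose]

theorem aeval_charDet_comp_neg_X {B : Type*} [Ring B] [Algebra K B] (b : B) :
    aeval b ((charDet A).comp (-X)) = aeval (-b) (charDet A) := by
  rw [aeval_comp, map_neg, aeval_X]

theorem hasEigenvalue_iff_aeval_charDet (μ : AlgebraicClosure K) :
    Module.End.HasEigenvalue (Matrix.toLin' (A.map (algebraMap K (AlgebraicClosure K)))) μ ↔
      aeval μ (charDet A) = 0 := by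
  rw [Module.End.hasEigenvalue_iff_isRoot_charpoly, Matrix.charpoly_toLin', Matrix.charpoly_map,
    IsRoot.def, eval_map_algebraMap, charDet_eq, map_mul]
  simp

theorem hasCommonDivisor_iff_hasOppositeEigenvalues :
    HasCommonDivisor A ↔ HasOppositeEigenvalues A := by
  constructor
  · rintro ⟨p, hp, hdvd, hdvd_neg⟩
    obtain ⟨μ, hμ⟩ := IsAlgClosed.exists_aeval_eq_zero (AlgebraicClosure K) p
      (natDegree_pos_iff_degree_pos.1 hp).ne'
    refine ⟨μ, -μ, ?_, ?_, add_neg_cancel μ⟩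
    · rw [hasEigenvalue_iff_aeval_charDet]
      exact aeval_eq_zero_of_dvd_aeval_eq_zero hdvd hμ
    · rw [hasEigenvalue_iff_aeval_charDet, ← aeval_charDet_comp_neg_X]
      exact aeval_eq_zero_of_dvd_aeval_eq_zero hdvd_neg hμ
  · rintro ⟨μ₁, μ₂, hμ₁, hμ₂, hadd⟩
    rw [hasEigenvalue_iff_aeval_charDet] at hμ₁ hμ₂
    refine ⟨minpoly K μ₁, minpoly.natDegree_pos (Algebra.IsIntegral.isIntegral μ₁),
      minpoly.dvd K μ₁ hμ₁, minpoly.dvd K μ₁ ?_⟩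
    rw [aeval_charDet_comp_neg_X, ← eq_neg_of_add_eq_zero_right hadd, hμ₂]

variable {A}

theorem isCoprime_charDet_of_not_hasCommonDivisor (hA : ¬HasCommonDivisor A) :
    IsCoprime (charDet A) ((charDet A).comp (-X)) :=
  isCoprime_of_irreducible_dvd (fun hzero => charDet_ne_zero A hzero.1)
    fun p hp hdvd hdvd_neg => hA ⟨p, hp.natDegree_pos, hdvd, hdvd_neg⟩

/- With `d = charDet A`, the relation `S (-A) = Aᵀ S` gives `S d(-A) = d(Aᵀ) S = 0`. Since
`d(A) = 0`, coprimality of `d(λ)` and `d(-λ)` would make `d(-A)` invertible. -/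
theorem hasCommonDivisor_of_transpose_mul_add_mul_eq_zero {S : Matrix (Fin m) (Fin m) K}
    (hS : S ≠ 0) (hAS : A.transpose * S + S * A = 0) : HasCommonDivisor A := by
  by_contra hA
  obtain ⟨p, q, hpq⟩ := isCoprime_charDet_of_not_hasCommonDivisor hA
  have hsemiconj : SemiconjBy S (-A) A.transpose := by
    rw [SemiconjBy, mul_neg]
    exact (eq_neg_of_add_eq_zero_left hAS).symm
  have hmul_zero : S * aeval (-A) (charDet A) = 0 := by
    rw [semiconjBy_aeval hsemiconj (charDet A), ← charDet_transpose, aeval_self_charDet, zero_mul]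
  have hinv : aeval (-A) (charDet A) * aeval A q = 1 := by
    simpa [aeval_self_charDet, aeval_charDet_comp_neg_X, mul_comm q] using congrArg (aeval A) hpq
  exact hS (by rw [← mul_one S, ← hinv, ← mul_assoc, hmul_zero, zero_mul])

end LinearAlgebra

section Lyapunov

variable {ι R : Type*} [Fintype ι] [DecidableEq ι] [CommRing R] (A : Matrix ι ι R)

open scoped Kronecker in
/-- The matrix of the Lyapunov operator `S ↦ Aᵀ S + S A` on square matrices, vectorized by
`S ↦ fun (i, j) => S i j`. Its determinant vanishes iff the operator has a nonzero kernel. -/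
def lyapunov : Matrix (ι × ι) (ι × ι) R :=
  A.transpose ⊗ₖ 1 + 1 ⊗ₖ A.transpose

theorem lyapunov_mulVec (S : Matrix ι ι R) :
    (lyapunov A).mulVec (fun p => S p.1 p.2) = fun p => (A.transpose * S + S * A) p.1 p.2 := by
  ext ⟨i, l⟩
  simp [lyapunov, Matrix.mulVec, dotProduct, Matrix.mul_apply, Matrix.one_apply, add_mul,
    Finset.sum_add_distrib, Fintype.sum_prod_type, mul_comm (A _ l)]

theorem det_lyapunov_eq_zero_iff [IsDomain R] :
    (lyapunov A).det = 0 ↔ ∃ S : Matrix ι ι R, S ≠ 0 ∧ A.transpose * S + S * A = 0 := by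
  rw [← Matrix.exists_mulVec_eq_zero_iff]
  constructor
  · rintro ⟨v, hv, hzero⟩
    refine ⟨Matrix.of fun i j => v (i, j), fun hS => hv ?_, ?_⟩
    · ext ⟨i, j⟩
      exact congrFun₂ hS i j
    · ext i j
      exact congrFun ((lyapunov_mulVec A (Matrix.of fun i j => v (i, j))).symm.trans hzero) (i, j)
  · rintro ⟨S, hS, hzero⟩
    refine ⟨fun p => S p.1 p.2, fun hv => hS ?_, ?_⟩
    · ext i j
      exact congrFun hv (i, j)
    · rw [lyapunov_mulVec, hzero]
      rfl

theorem det_lyapunov_map {R' : Type*} [CommRing R'] (φ : R →+* R') :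
    (lyapunov (A.map φ)).det = φ (lyapunov A).det := by
  rw [RingHom.map_det]
  congr 1
  ext ⟨i, l⟩ ⟨j, k⟩
  simp [lyapunov, Matrix.one_apply, apply_ite φ]

end Lyapunov

section Analytic

variable {U : Set (Jet n m h)} {V : Set (Coord n m h)} {r : WithTop ℕ∞}

namespace IsFunOf

theorem sum {ι : Type*} {s : Finset ι} {f : ι → JetFun n m h}
    (hf : ∀ i ∈ s, IsFunOf U V r (f i)) : IsFunOf U V r (fun θ => ∑ i ∈ s, f i θ) := by
  classical
  induction s using Finset.induction with
  | empty => simpa using IsFunOf.const U V r 0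
  | insert a s ha ih =>
    simp_rw [Finset.sum_insert ha]
    exact (hf a (Finset.mem_insert_self _ _)).add
      (ih fun i hi => hf i (Finset.mem_insert_of_mem hi))

theorem prod {ι : Type*} {s : Finset ι} {f : ι → JetFun n m h}
    (hf : ∀ i ∈ s, IsFunOf U V r (f i)) : IsFunOf U V r (fun θ => ∏ i ∈ s, f i θ) := by
  classical
  induction s using Finset.induction with
  | empty => simpa using IsFunOf.const U V r 1
  | insert a s ha ih =>
    simp_rw [Finset.prod_insert ha]
    exact (hf a (Finset.mem_insert_self _ _)).mul
      (ih fun i hi => hf i (Finset.mem_insert_of_mem hi))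

theorem det {ι : Type*} [Fintype ι] [DecidableEq ι] {B : Jet n m h → Matrix ι ι ℝ}
    (hB : ∀ i j, IsFunOf U V r (fun θ => B θ i j)) : IsFunOf U V r (fun θ => (B θ).det) := by
  simp_rw [Matrix.det_apply']
  exact sum fun σ _ => (IsFunOf.const U V r _).mul (prod fun i _ => hB _ _)

theorem continuousOn {f : JetFun n m h} (hf : IsFunOf U V r f) : ContinuousOn f U := by
  obtain ⟨s, -, g, hg, hfg⟩ := hf
  exact (hg.continuousOn.comp (Finset.continuous_restrict s).continuousOn
    (Set.mapsTo_image _ _)).congr hfg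

theorem eq_zero_of_isPreconnected {f : JetFun n m h} (hf : IsFunOf U V ω f) (hU : IsOpen U)
    (hconn : IsPreconnected U) {W : Set (Jet n m h)} (hW : IsOpen W) (hWU : W ⊆ U)
    (hne : W.Nonempty) (hzero : ∀ θ ∈ W, f θ = 0) {θ : Jet n m h} (hθ : θ ∈ U) : f θ = 0 := by
  obtain ⟨s, -, g, hg, hfg⟩ := hf
  obtain ⟨θ₀, hθ₀⟩ := hne
  have hg_analytic : AnalyticOnNhd ℝ g (s.restrict '' U) := fun y hy =>
    (hg.contDiffAt ((isOpen_restrict_image hU s).mem_nhds hy)).analyticAt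
  have hg_zero : g =ᶠ[nhds (s.restrict θ₀)] 0 := by
    filter_upwards [(isOpen_restrict_image hW s).mem_nhds ⟨θ₀, hθ₀, rfl⟩]
    rintro _ ⟨η, hη, rfl⟩
    rw [← hfg η (hWU hη), hzero η hη]
    rfl
  rw [hfg θ hθ]
  exact hg_analytic.eqOn_zero_of_preconnected_of_eventuallyEq_zero
    (hconn.image _ (Finset.continuous_restrict s).continuousOn) ⟨θ₀, hWU hθ₀, rfl⟩ hg_zero
    ⟨θ, hθ, rfl⟩

theorem eval_symbolMatrix {k : ℕ} {f : Fin k → JetFun n m h} (hf : ∀ i, IsFunOf U V r (f i))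
    (hU : IsOpen U) {r' : WithTop ℕ∞} (hr : r' + 1 ≤ r) (a b : ℕ) (q : Fin n → ℝ) (i : Fin k)
    (j : Fin m) : IsFunOf U V r' (fun θ => MvPolynomial.eval q (symbolMatrix a b f θ i j)) := by
  simp only [symbolMatrix, Matrix.of_apply, map_sum, MvPolynomial.eval_monomial]
  refine sum fun I _ => IsFunOf.mul ?_ (IsFunOf.const U V r' _)
  split_ifs
  · exact (hf i).pd hU hr _
  · exact IsFunOf.const U V r' 0

theorem eval_det_lyapunov {f : Fin m → JetFun n m h} (hf : ∀ i, IsFunOf U V r (f i))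
    (hU : IsOpen U) {r' : WithTop ℕ∞} (hr : r' + 1 ≤ r) (a b : ℕ) (q : Fin n → ℝ) :
    IsFunOf U V r' (fun θ => MvPolynomial.eval q (lyapunov (symbolMatrix a b f θ)).det) := by
  simp_rw [← det_lyapunov_map]
  refine det ?_
  rintro ⟨i, l⟩ ⟨j, k⟩
  simp only [lyapunov, Matrix.add_apply, Matrix.kroneckerMap_apply, Matrix.transpose_apply,
    Matrix.map_apply]
  exact ((eval_symbolMatrix hf hU hr a b q j i).mul (IsFunOf.const U V r' _)).add
    ((IsFunOf.const U V r' _).mul (eval_symbolMatrix hf hU hr a b q k l))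

end IsFunOf

theorem det_lyapunov_symbol_eq_zero {f : Fin m → JetFun n m h} (hf : ∀ i, IsFunOf U V ω (f i))
    (hU : IsOpen U) (hconn : IsPreconnected U) {W : Set (Jet n m h)} (hW : IsOpen W) (hWU : W ⊆ U)
    (hne : W.Nonempty) (hzero : ∀ θ ∈ W, (lyapunov (symbol U f θ)).det = 0) {θ : Jet n m h}
    (hθ : θ ∈ U) : (lyapunov (symbol U f θ)).det = 0 := by
  refine MvPolynomial.funext fun q => ?_
  rw [map_zero]
  refine (IsFunOf.eval_det_lyapunov hf hU le_rfl _ _ q).eq_zero_of_isPreconnected hU hconn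
    hW hWU hne (fun η hη => ?_) hθ
  rw [← symbol, hzero η hη, map_zero]

theorem isOpen_symbol_ne_zero {k : ℕ} {f : Fin k → JetFun n m h} (hf : ∀ i, IsSmooth U (f i))
    (hU : IsOpen U) : IsOpen {θ ∈ U | symbol U f θ ≠ 0} := by
  refine isOpen_iff_mem_nhds.2 fun θ ⟨hθ, hne⟩ => ?_
  obtain ⟨i, j, s, I, hpd, hI, hs⟩ := exists_pd_ne_zero_of_symbol_ne_zero hne
  have hopen : IsOpen (U ∩ pd (.u j s I) (f i) ⁻¹' {0}ᶜ) :=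
    ((hf i).pd hU _).continuousOn.isOpen_inter_preimage hU isOpen_compl_singleton
  filter_upwards [hopen.mem_nhds ⟨hθ, hpd⟩] with η hη
  exact ⟨hη.1, symbol_ne_zero_of_pd_ne_zero hη.2 hI hs⟩

end Analytic

theorem GenEvolSystem.hasCommonDivisor_and_hasOppositeEigenvalues {E : GenEvolSystem n m h}
    {θ : Jet n m h} (hdet : (lyapunov (symbol E.U E.F θ)).det = 0) :
    HasCommonDivisor (E.A θ) ∧ HasOppositeEigenvalues (E.A θ) := by
  have hdet_A : (lyapunov (E.A θ)).det = 0 := by rw [A, det_lyapunov_map, hdet, map_zero]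
  obtain ⟨S, hS, hAS⟩ := (det_lyapunov_eq_zero_iff _).1 hdet_A
  have hdiv := hasCommonDivisor_of_transpose_mul_add_mul_eq_zero hS hAS
  exact ⟨hdiv, (hasCommonDivisor_iff_hasOppositeEigenvalues _).1 hdiv⟩

end GenEvol

end

theorem theorem4 {n m h : ℕ} (E : GenEvol.GenEvolSystem n m h) (hN : 0 < E.N)
    (hodd : Odd (E.N + h))
    (c : Set (Fin (n + 1) → GenEvol.JetFun n m h)) (hc : E.IsConservationLaw c)
    (χ : Fin m → GenEvol.JetFun n m h) (hχ : E.IsCharacteristic c χ)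
    (hO : E.O < GenEvol.order E.U χ) :
    (∃ θ ∈ E.U, GenEvol.symbol E.U χ θ ≠ 0) ∧
    (∀ θ ∈ E.U, GenEvol.symbol E.U χ θ ≠ 0 →
      GenEvol.HasCommonDivisor (E.A θ) ∧ GenEvol.HasOppositeEigenvalues (E.A θ)) ∧
    (IsPreconnected E.U → (∀ i, GenEvol.IsFunOf E.U Set.univ ω (E.F i)) →
      ∀ θ ∈ E.U,
        GenEvol.HasCommonDivisor (E.A θ) ∧ GenEvol.HasOppositeEigenvalues (E.A θ)) ∧
    (∀ θ ∈ E.U,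
      GenEvol.HasCommonDivisor (E.A θ) ↔ GenEvol.HasOppositeEigenvalues (E.A θ)) := by
  obtain ⟨_, -, rfl⟩ := hc
  obtain ⟨J, ⟨hJ, -⟩, hχJ⟩ := hχ
  have hsmooth := hJ.isSmooth_characteristic hχJ
  have hexists : ∃ θ ∈ E.U, GenEvol.symbol E.U χ θ ≠ 0 :=
    GenEvol.exists_symbol_ne_zero E.isOpen_U hsmooth (E.neg_one_le_O.trans_lt hO).ne'
  have hdet : ∀ θ ∈ {θ ∈ E.U | GenEvol.symbol E.U χ θ ≠ 0},
      (GenEvol.lyapunov (GenEvol.symbol E.U E.F θ)).det = 0 := fun θ ⟨hθ, hne⟩ =>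
    (GenEvol.det_lyapunov_eq_zero_iff _).2
      ⟨_, hne, hJ.transpose_symbol_mul_add_mul_symbol_eq_zero hN hodd hχJ hO hθ⟩
  refine ⟨hexists, fun θ hθ hne => ?_, fun hconn hF θ hθ => ?_, fun θ _ => ?_⟩
  · exact GenEvol.GenEvolSystem.hasCommonDivisor_and_hasOppositeEigenvalues (hdet θ ⟨hθ, hne⟩)
  · exact GenEvol.GenEvolSystem.hasCommonDivisor_and_hasOppositeEigenvalues
      (GenEvol.det_lyapunov_symbol_eq_zero hF E.isOpen_U hconn
        (GenEvol.isOpen_symbol_ne_zero hsmooth E.isOpen_U) (fun _ hη => hη.1) hexists hdet hθ)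
  · exact GenEvol.hasCommonDivisor_iff_hasOppositeEigenvalues _
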